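/- Let $\varepsilon>0$, let $(k_x,k_y)$ be a unit vector of $\mathbb R^2$ with $k_x>0$ and $k_y\neq 0$, let $\nu>0$ be constant, and let $g\in\mathcal S'(\mathbb R)$ be a tempered distribution. Write $\mathcal F_y$ for the Fourier transform in $y$ with kernel $e^{-i\eta y}$, let $\sqrt{\ }$ be the principal square root (positive real part), and put $$R_-(i\eta)= i\frac{k_x\eta}{k_y}-\frac{i k_x}{\varepsilon k_y^2}\Bigl(1-\sqrt{1-\tfrac{2\varepsilon k_y\eta}{k_x^2}+\tfrac{2i\nu\varepsilon k_y^2}{k_x^2}}\Bigr).$$ Consider the half-plane problem $$i(k_x\partial_x+k_y\partial_y)u+\frac{\varepsilon}{2}\bigl(k_x^2\partial_{yy}-2k_xk_y\partial_{xy}+k_y^2\partial_{xx}\bigr)u+i\nu u=0\quad\text{on }\mathbb R_+\times\mathbb R,$$ $$i\varepsilon k_y(k_x\partial_y-k_y\partial_x)u|_{x=0}+2k_x u|_{x=0}=2k_x g .$$ Among the $u\in C^\infty_x([0,\infty),\mathcal S'_y(\mathbb R))$ that are tempered distributions on the half-plane (i.e. the extension of $u$ by zero to $x<0$ is a tempered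 distribution on $\mathbb R^2$), this problem has exactly one solution. For every $x\ge 0$ it is given by $$\mathcal F_y u(x,\eta)=\frac{2\,\mathcal F_y g(\eta)}{1+\sqrt{1-\frac{2\varepsilon k_y\eta}{k_x^2}+\frac{2i\nu\varepsilon k_y^2}{k_x^2}}}\;e^{R_-(i\eta)x},$$ where the factors multiplying $\mathcal F_y g$ are smooth functions of $\eta$ which, with all their derivatives, have at most polynomial growth. It also satisfies $(\partial_x-R_-(i\eta))\mathcal F_y u(x,\eta)=0$ for every $x\ge 0$, where $R_-(i\eta)$ is likewise smooth with all derivatives of at most polynomial growth. -/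

import Mathlib

open Set MeasureTheory FourierTransform
open scoped SchwartzMap

noncomputable section

namespace TiltedParaxial

/-- The Fourier transform in angular frequency on Schwartz functions,
`φ ↦ (η ↦ ∫ exp (-i η y) φ(y) dy)`; Mathlib's `𝓕` is normalised with the kernel
`exp (-2 π i η y)`, hence the rescaling of the frequency by `(2π)⁻¹`. -/
def fourierSchwartz : 𝓢(ℝ, ℂ) →L[ℂ] 𝓢(ℝ, ℂ) :=
  (SchwartzMap.compCLMOfContinuousLinearEquiv ℂ
      (ContinuousLinearEquiv.unitsEquivAut ℝ (Units.mk0 (2 * Real.pi)⁻¹ (by positivity)))).comp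
    (fourierCLM ℂ 𝓢(ℝ, ℂ))

/-- The Fourier transform `F_y` in angular frequency on tempered distributions, by duality:
`⟨F_y T, φ⟩ = ⟨T, F_y φ⟩`. -/
def fourierY : 𝓢'(ℝ, ℂ) →L[ℂ] 𝓢'(ℝ, ℂ) :=
  PointwiseConvergenceCLM.precomp ℂ fourierSchwartz

/-- The distributional derivative `∂_y` on `S'_y(ℝ)`. -/
def dy : 𝓢'(ℝ, ℂ) →L[ℂ] 𝓢'(ℝ, ℂ) := TemperedDistribution.derivCLM ℂ

/-- The derivative `∂_x` of an `S'_y(ℝ)`-valued function on the closed half-line `[0, ∞)`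
(one-sided at `x = 0`). -/
def dx (u : ℝ → 𝓢'(ℝ, ℂ)) (x : ℝ) : 𝓢'(ℝ, ℂ) := derivWithin u (Ici 0) x

/-- `u ∈ C^∞_x(ℝ₊, S'_y(ℝ))`: all iterated `x`-derivatives exist on `[0, ∞)`. -/
def IsSmooth (u : ℝ → 𝓢'(ℝ, ℂ)) : Prop :=
  ∀ n : ℕ, DifferentiableOn ℝ (dx^[n] u) (Ici 0)

/-- The restriction `Φ ↦ Φ(x, ·)` of a Schwartz function of `(x, y)` to a vertical line. -/
def slice (x : ℝ) : 𝓢(ℝ × ℝ, ℂ) →L[ℂ] 𝓢(ℝ, ℂ) :=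
  SchwartzMap.compCLM ℂ (g := fun y : ℝ => (x, y))
    (by
      have h := (Function.HasTemperateGrowth.const ((x, 0) : ℝ × ℝ)).add
        (ContinuousLinearMap.inr ℝ ℝ ℝ).hasTemperateGrowth
      convert h using 2
      ext <;> simp)
    ⟨1, 1, fun y => by
      have h : ‖y‖ ≤ ‖((x, y) : ℝ × ℝ)‖ := norm_snd_le (x, y)
      rw [pow_one, one_mul]
      linarith⟩

/-- `u` is a tempered distribution on the half-plane: the distribution
`Φ ↦ ∫_{x > 0} ⟨u(x), Φ(x, ·)⟩ dx` on `ℝ²` (the extension of `u` by zero), which for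
`u` continuous in `x` is well defined on compactly supported test functions, extends to a
tempered distribution. -/
def IsTempered (u : ℝ → 𝓢'(ℝ, ℂ)) : Prop :=
  ∃ U : 𝓢'(ℝ × ℝ, ℂ), ∀ Φ : 𝓢(ℝ × ℝ, ℂ), HasCompactSupport Φ →
    U Φ = ∫ x in Ioi (0 : ℝ), u x (slice x Φ)

/-- The equation
`i(k_x ∂_x + k_y ∂_y)u + (ε/2)(k_x² ∂_yy - 2 k_x k_y ∂_xy + k_y² ∂_xx)u + iνu = 0`
on `ℝ₊ × ℝ`. -/
def SatisfiesEquation (ε ν kx ky : ℝ) (u : ℝ → 𝓢'(ℝ, ℂ)) : Prop :=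
  ∀ x : ℝ, 0 ≤ x →
    Complex.I • ((kx : ℂ) • dx u x + (ky : ℂ) • dy (u x))
      + ((ε : ℂ) / 2) • (((kx : ℂ) ^ 2) • dy (dy (u x))
          - (2 * (kx : ℂ) * (ky : ℂ)) • dy (dx u x)
          + ((ky : ℂ) ^ 2) • dx (dx u) x)
      + (Complex.I * (ν : ℂ)) • u x = 0

/-- The entrance condition `iεk_y(k_x ∂_y - k_y ∂_x)u|_{x=0} + 2k_x u|_{x=0} = 2k_x g`. -/
def SatisfiesEntrance (ε kx ky : ℝ) (g : 𝓢'(ℝ, ℂ)) (u : ℝ → 𝓢'(ℝ, ℂ)) : Prop :=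
  (Complex.I * (ε : ℂ) * (ky : ℂ)) • ((kx : ℂ) • dy (u 0) - (ky : ℂ) • dx u 0)
    + (2 * (kx : ℂ)) • u 0 = (2 * (kx : ℂ)) • g

/-- Solutions of the half-plane problem: tempered distributions in `C^∞_x(ℝ₊, S'_y(ℝ))`
satisfying the equation and the entrance condition. Only the values of `u` on `[0, ∞)` matter. -/
structure IsSolution (ε ν kx ky : ℝ) (g : 𝓢'(ℝ, ℂ)) (u : ℝ → 𝓢'(ℝ, ℂ)) : Prop where
  smooth : IsSmooth u
  tempered : IsTempered u
  equation : SatisfiesEquation ε ν kx ky u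
  entrance : SatisfiesEntrance ε kx ky g u

/-- The principal square root `√(1 - 2εk_yη/k_x² + 2iνεk_y²/k_x²)`. -/
def root (ε ν kx ky η : ℝ) : ℂ :=
  Complex.sqrt (1 - 2 * ((ε : ℂ) * ky * η / (kx : ℂ) ^ 2)
    + 2 * Complex.I * ν * ((ε : ℂ) * (ky : ℂ) ^ 2 / (kx : ℂ) ^ 2))

/-- `R_-(iη) = i k_x η / k_y - i k_x / (ε k_y²) (1 - √(1 - 2εk_yη/k_x² + 2iνεk_y²/k_x²))`. -/
def Rminus (ε ν kx ky η : ℝ) : ℂ :=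
  Complex.I * ((kx : ℂ) * η / ky)
    - Complex.I * ((kx : ℂ) / ((ε : ℂ) * (ky : ℂ) ^ 2)) * (1 - root ε ν kx ky η)

/-- The multiplier `2 / (1 + √(…)) · exp(R_-(iη) x)`. -/
def solutionSymbol (ε ν kx ky x η : ℝ) : ℂ :=
  2 / (1 + root ε ν kx ky η) * Complex.exp (Rminus ε ν kx ky η * x)

end TiltedParaxial

end

open TiltedParaxial

/-! After a Fourier transform in `y` the equation becomes `(ε ky²/2) (∂ₓ - R₋)(∂ₓ - R₊) û = 0`, up
to sign; `coeff_zero_eq` and `coeff_one_eq` are the factorisation. Since `ν > 0`, the radicand has a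
positive imaginary part that does not depend on `η`, so its principal root has positive imaginary
part, and `Re R₋ < 0 < Re R₊ = -Re R₋`. The product of the real and imaginary parts of the root is
constant, so `1 / Re R₋` is a multiple of the real part of the root: the damping may degenerate at
large frequency, but only polynomially. Hence for `A = R₋` and for `A = -R₊` the test functions `exp
(A x) φ` tend to zero in the Schwartz space faster than any power of `x`
(`exists_pow_mul_seminorm_expMul_le`).

Existence: `exp (R₋ x) û(0)` solves the equation, and the decay makes it tempered. On this mode the
entrance operator is multiplication by `kx (1 + √…)`, which never vanishes and so determines `û(0)`.

Uniqueness: for a solution, `z = (∂ₓ - R₋) û` satisfies `∂ₓ z = R₊ z`, so that `⟨z(a + t), exp (-R₊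
t) φ⟩ = ⟨z(a), φ⟩` for all `t ≥ 0`. Temperedness controls `z` only after averaging in `x`, so it is
tested against a bump translated by `a + n`, tensored with `exp (-R₊ (n + 1)) φ`. The translation
costs a power of `n`, the exponential gains every power, and the pairing does not depend on `n`; it
is therefore zero (`integral_mul_expMul_eq_zero`). Thus `z = 0`, and `û` is governed by the
first-order equation with symbol `R₋`.

Operators act on distributions by transposition. The Banach–Steinhaus theorem on the Fréchet space
of Schwartz functions supplies the uniform bounds, and the product rule for a moving distribution
evaluated at a moving test function. -/

namespace TiltedParaxial

open Filter Topology

/-! ### Seminorms and completeness of the Schwartz space. -/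

section Schwartz

theorem iteratedDeriv_eq_derivCLM_iterate (n : ℕ) (φ : 𝓢(ℝ, ℂ)) :
    iteratedDeriv n φ = ((SchwartzMap.derivCLM ℂ ℂ)^[n] φ : 𝓢(ℝ, ℂ)) := by
  induction n generalizing φ with
  | zero => simp
  | succ n ih => rw [iteratedDeriv_succ', Function.iterate_succ_apply, ← ih]; rfl

theorem seminorm_succ (k n : ℕ) (φ : 𝓢(ℝ, ℂ)) :
    SchwartzMap.seminorm ℂ k (n + 1) φ =
      SchwartzMap.seminorm ℂ k n (SchwartzMap.derivCLM ℂ ℂ φ) := by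
  have h : iteratedDeriv (n + 1) φ = iteratedDeriv n (SchwartzMap.derivCLM ℂ ℂ φ) := by
    rw [iteratedDeriv_succ']; rfl
  apply le_antisymm
  · refine SchwartzMap.seminorm_le_bound' ℂ k _ φ (apply_nonneg _ _) fun x => ?_
    rw [h]
    exact SchwartzMap.le_seminorm' ℂ k n _ x
  · refine SchwartzMap.seminorm_le_bound' ℂ k _ _ (apply_nonneg _ _) fun x => ?_
    rw [← h]
    exact SchwartzMap.le_seminorm' ℂ k (n + 1) φ x

theorem seminorm_zero_le_bound (k : ℕ) (φ : 𝓢(ℝ, ℂ)) {M : ℝ} (hM : 0 ≤ M)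
    (h : ∀ x, |x| ^ k * ‖φ x‖ ≤ M) : SchwartzMap.seminorm ℂ k 0 φ ≤ M :=
  SchwartzMap.seminorm_le_bound' ℂ k 0 φ hM (by simpa using h)

theorem le_seminorm_zero (k : ℕ) (φ : 𝓢(ℝ, ℂ)) (x : ℝ) :
    |x| ^ k * ‖φ x‖ ≤ SchwartzMap.seminorm ℂ k 0 φ := by
  simpa using SchwartzMap.norm_pow_mul_le_seminorm ℂ φ k x

theorem hasTemperateGrowth_pow (k : ℕ) : (fun x : ℝ => (x : ℂ) ^ k).HasTemperateGrowth :=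
  Function.Complex.hasTemperateGrowth_ofReal.pow k

/-- The bounded continuous function `x ↦ x ^ k * φ⁽ⁿ⁾ x`. -/
noncomputable def weightedDeriv (k n : ℕ) : 𝓢(ℝ, ℂ) →L[ℂ] BoundedContinuousFunction ℝ ℂ :=
  (SchwartzMap.toBoundedContinuousFunctionCLM ℂ ℝ ℂ).comp
    ((SchwartzMap.smulLeftCLM ℂ fun x : ℝ => (x : ℂ) ^ k).comp
      ((SchwartzMap.derivCLM ℂ ℂ) ^ n))

theorem weightedDeriv_apply (k n : ℕ) (φ : 𝓢(ℝ, ℂ)) (x : ℝ) :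
    weightedDeriv k n φ x = (x : ℂ) ^ k * iteratedDeriv n φ x := by
  rw [iteratedDeriv_eq_derivCLM_iterate]
  simp [weightedDeriv, SchwartzMap.smulLeftCLM_apply_apply (hasTemperateGrowth_pow k)]

instance : (uniformity 𝓢(ℝ, ℂ)).IsCountablyGenerated :=
  IsUniformAddGroup.uniformity_countably_generated

/-- Completeness, with the countably generated uniformity, makes the Schwartz space Baire and hence
barrelled, as Banach–Steinhaus requires. Along a Cauchy sequence each `x ^ k * φ⁽ⁿ⁾` converges
uniformly; uniform convergence of derivatives identifies the limits for `k = 0` as the successive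
derivatives of one function. -/
instance completeSpace_schwartz : CompleteSpace 𝓢(ℝ, ℂ) := by
  apply UniformSpace.complete_of_cauchySeq_tendsto
  intro u hu
  have hlim : ∀ k n, ∃ G, Tendsto (fun m => weightedDeriv k n (u m)) atTop (𝓝 G) := fun k n =>
    cauchySeq_tendsto_of_complete (hu.map (weightedDeriv k n).uniformContinuous)
  choose G hG using hlim
  have hpt : ∀ (k n : ℕ) (x : ℝ), Tendsto (fun m => (x : ℂ) ^ k * iteratedDeriv n (u m) x) atTop
      (𝓝 (G k n x)) := by
    intro k n x
    have h := (continuous_eval_const (F := BoundedContinuousFunction ℝ ℂ) x).continuousAt.tendsto.comp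
      (hG k n)
    simpa [Function.comp_def, weightedDeriv_apply] using h
  have hGk : ∀ k n x, G k n x = (x : ℂ) ^ k * G 0 n x := by
    intro k n x
    refine tendsto_nhds_unique (hpt k n x) ?_
    simpa using (hpt 0 n x).const_mul ((x : ℂ) ^ k)
  have hder : ∀ n x, HasDerivAt (G 0 n) (G 0 (n + 1) x) x := by
    intro n
    refine hasDerivAt_of_tendstoUniformly (l := atTop) (f := fun m => iteratedDeriv n (u m))
      (f' := fun m => iteratedDeriv (n + 1) (u m)) ?_ ?_ ?_
    · have h := BoundedContinuousFunction.tendsto_iff_tendstoUniformly.1 (hG 0 (n + 1))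
      have he : ∀ m, ⇑(weightedDeriv 0 (n + 1) (u m)) = iteratedDeriv (n + 1) (u m) :=
        fun m => funext fun x => by simp [weightedDeriv_apply]
      simpa only [he] using h
    · refine Eventually.of_forall fun m x => ?_
      rw [iteratedDeriv_succ, iteratedDeriv_eq_derivCLM_iterate]
      exact SchwartzMap.hasDerivAt _ x
    · intro x
      simpa using hpt 0 n x
  have hiter : ∀ n, iteratedDeriv n (G 0 0) = G 0 n := by
    intro n
    induction n with
    | zero => simp
    | succ n ih =>
      rw [iteratedDeriv_succ, ih]
      exact funext fun x => (hder n x).deriv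
  let g : 𝓢(ℝ, ℂ) :=
    { toFun := G 0 0
      smooth' := contDiff_of_differentiable_iteratedDeriv fun m _ => by
        rw [hiter]
        exact fun x => (hder m x).differentiableAt
      decay' := fun k n => ⟨‖G k n‖, fun x => by
        rw [norm_iteratedFDeriv_eq_norm_iteratedDeriv, hiter]
        have h := (G k n).norm_coe_le_norm x
        rw [hGk, norm_mul, norm_pow, Complex.norm_real] at h
        exact h⟩ }
  have hg : ∀ n, iteratedDeriv n g = G 0 n := hiter
  refine ⟨g, ((schwartz_withSeminorms ℂ ℝ ℂ).tendsto_nhds _ _).2 ?_⟩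
  rintro ⟨k, n⟩ ε hε
  have h := (tendsto_iff_norm_sub_tendsto_zero.1 (hG k n)).eventually (gt_mem_nhds hε)
  filter_upwards [h] with m hm
  refine lt_of_le_of_lt ?_ hm
  refine SchwartzMap.seminorm_le_bound' ℂ k n _ (norm_nonneg _) fun x => ?_
  have h1 := (weightedDeriv k n (u m) - G k n).norm_coe_le_norm x
  have h2 : weightedDeriv k n g = G k n := by
    ext x
    rw [weightedDeriv_apply, hg, ← hGk]
  rw [← h2, ← map_sub] at h1 ⊢
  rw [weightedDeriv_apply, norm_mul, norm_pow, Complex.norm_real] at h1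
  exact h1

end Schwartz

/-! ### Equicontinuity of families of tempered distributions. -/

section BanachSteinhaus

/-- A pointwise bounded family of tempered distributions is equicontinuous. -/
theorem exists_bound_of_pointwise_bounded {ι : Type*} (T : ι → 𝓢'(ℝ, ℂ))
    (h : ∀ φ, ∃ C, ∀ i, ‖T i φ‖ ≤ C) :
    ∃ (s : Finset (ℕ × ℕ)) (C : ℝ), 0 ≤ C ∧
      ∀ i φ, ‖T i φ‖ ≤ C * (s.sup (schwartzSeminormFamily ℂ ℝ ℂ)) φ := by
  have hu : UniformEquicontinuous (DFunLike.coe ∘ fun i => (T i : 𝓢(ℝ, ℂ) →L[ℂ] ℂ)) := by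
    refine (norm_withSeminorms ℂ ℂ).banach_steinhaus fun _ φ => ?_
    obtain ⟨C, hC⟩ := h φ
    exact ⟨C, by rintro _ ⟨i, rfl⟩; exact hC i⟩
  obtain ⟨p, hp, hle⟩ :=
    ((norm_withSeminorms ℂ ℂ).uniformEquicontinuous_iff_exists_continuous_seminorm
      (fun i => ((T i : 𝓢(ℝ, ℂ) →L[ℂ] ℂ) : 𝓢(ℝ, ℂ) →ₗ[ℂ] ℂ))).1 hu 0
  obtain ⟨s, C, -, hC⟩ := Seminorm.bound_of_continuous (schwartz_withSeminorms ℂ ℝ ℂ) p hp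
  exact ⟨s, C, C.2, fun i φ => (hle i φ).trans (hC φ)⟩

theorem exists_bound (T : 𝓢'(ℝ, ℂ)) :
    ∃ (s : Finset (ℕ × ℕ)) (C : ℝ), 0 ≤ C ∧
      ∀ φ, ‖T φ‖ ≤ C * (s.sup (schwartzSeminormFamily ℂ ℝ ℂ)) φ := by
  obtain ⟨s, C, hC, h⟩ := exists_bound_of_pointwise_bounded (fun _ : Unit => T)
    fun φ => ⟨‖T φ‖, fun _ => le_rfl⟩
  exact ⟨s, C, hC, h ()⟩

/-- Evaluation of tempered distributions is jointly sequentially continuous. -/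
theorem tendsto_apply_of_tendsto {α : Type*} {l : Filter α} [l.IsCountablyGenerated]
    {T : α → 𝓢'(ℝ, ℂ)} {T₀ : 𝓢'(ℝ, ℂ)} {φ : α → 𝓢(ℝ, ℂ)} {φ₀ : 𝓢(ℝ, ℂ)}
    (hT : ∀ ψ, Tendsto (fun a => T a ψ) l (𝓝 (T₀ ψ))) (hφ : Tendsto φ l (𝓝 φ₀)) :
    Tendsto (fun a => T a (φ a)) l (𝓝 (T₀ φ₀)) := by
  -- Along a sequence, convergence bounds the whole range, which is what Banach–Steinhaus needs;
  -- along a general filter it would bound only a tail.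
  refine tendsto_of_seq_tendsto fun a ha => ?_
  obtain ⟨s, C, hC, hb⟩ := exists_bound_of_pointwise_bounded (fun n => T (a n)) fun ψ => by
    obtain ⟨C, hC⟩ := ((hT ψ).comp ha).norm.bddAbove_range
    exact ⟨C, fun n => hC ⟨n, rfl⟩⟩
  have h0 : Tendsto (fun n => φ (a n) - φ₀) atTop (𝓝 0) := by
    simpa using (hφ.comp ha).sub_const φ₀
  have hp : Tendsto (fun n => C * (s.sup (schwartzSeminormFamily ℂ ℝ ℂ)) (φ (a n) - φ₀)) atTop
      (𝓝 0) := by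
    have hc : Continuous ⇑(s.sup (schwartzSeminormFamily ℂ ℝ ℂ)) := by
      refine Seminorm.continuous_finsetSup ?_
      exact fun i _ => (schwartz_withSeminorms ℂ ℝ ℂ).continuous_seminorm i
    simpa using (hc.tendsto' 0 0 (map_zero _)).comp h0 |>.const_mul C
  have h1 : Tendsto (fun n => T (a n) (φ (a n) - φ₀)) atTop (𝓝 0) :=
    squeeze_zero_norm (fun n => hb n _) hp
  have h2 := h1.add ((hT φ₀).comp ha)
  simpa [Function.comp_def] using h2

end BanachSteinhaus

/-! ### Differentiation of distribution-valued functions. -/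

section Derivative

instance : ContinuousSMul ℝ 𝓢'(ℝ, ℂ) :=
  (PointwiseConvergenceCLM.isEmbedding_coeFn (RingHom.id ℂ) 𝓢(ℝ, ℂ) ℂ).isInducing.continuousSMul
    continuous_id rfl

variable {T : ℝ → 𝓢'(ℝ, ℂ)} {T' : 𝓢'(ℝ, ℂ)} {s : Set ℝ} {x : ℝ}

/-- The topology on tempered distributions is that of pointwise convergence, so the condition on the
remainder can be checked one test function at a time. -/
theorem hasFDerivWithinAt_iff_forall_apply {L : ℝ →L[ℝ] 𝓢'(ℝ, ℂ)} :
    HasFDerivWithinAt T L s x ↔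
      ∀ φ, HasDerivWithinAt (fun t => T t φ) (L 1 φ) s x := by
  rw [hasFDerivWithinAt_iff_isLittleOTVS,
    Asymptotics.isLittleOTVS_iff_tendsto_inv_smul
      (Eventually.of_forall fun y hy => by simp [sub_eq_zero.1 hy]),
    PointwiseConvergenceCLM.tendsto_iff_forall_tendsto]
  refine forall_congr' fun φ => ?_
  rw [hasDerivWithinAt_iff_hasFDerivWithinAt, hasFDerivWithinAt_iff_isLittleOTVS,
    Asymptotics.isLittleOTVS_iff_tendsto_inv_smul
      (Eventually.of_forall fun y hy => by simp [sub_eq_zero.1 hy])]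
  have hL : ∀ t : ℝ, L t φ = t • L 1 φ := fun t => by
    conv_lhs => rw [← mul_one t, ← smul_eq_mul, map_smul]
    rfl
  refine Iff.of_eq (congrArg (fun f => Tendsto f (𝓝[s] x) (𝓝 (0 : ℂ))) (funext fun y => ?_))
  change (y - x)⁻¹ • (T y φ - T x φ - L (y - x) φ)
    = (y - x)⁻¹ • (T y φ - T x φ - (y - x) • L 1 φ)
  rw [hL]

/-- The derivative of a family of tempered distributions may be computed after evaluation at each
test function. -/
theorem differentiableWithinAt_and_derivWithin_eq (hs : UniqueDiffWithinAt ℝ s x)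
    (h : ∀ φ, HasDerivWithinAt (fun t => T t φ) (T' φ) s x) :
    DifferentiableWithinAt ℝ T s x ∧ derivWithin T s x = T' := by
  have hd : DifferentiableWithinAt ℝ T s x := by
    refine ⟨ContinuousLinearMap.toSpanSingleton ℝ T', hasFDerivWithinAt_iff_forall_apply.2 ?_⟩
    simpa using h
  refine ⟨hd, ?_⟩
  have h' := hasFDerivWithinAt_iff_forall_apply.1 hd.hasFDerivWithinAt
  ext φ
  exact hs.eq_deriv _ (h' φ) (h φ)

theorem hasDerivWithinAt_apply (h : DifferentiableWithinAt ℝ T s x) (φ : 𝓢(ℝ, ℂ)) :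
    HasDerivWithinAt (fun t => T t φ) (derivWithin T s x φ) s x :=
  hasFDerivWithinAt_iff_forall_apply.1 h.hasFDerivWithinAt φ

/-- Product rule for the evaluation of a family of tempered distributions at a family of test
functions. -/
theorem hasDerivWithinAt_apply_family {φ : ℝ → 𝓢(ℝ, ℂ)} {φ' : 𝓢(ℝ, ℂ)}
    (hT : ∀ ψ, HasDerivWithinAt (fun t => T t ψ) (T' ψ) s x)
    (hφ : Tendsto (slope φ x) (𝓝[s \ {x}] x) (𝓝 φ')) :
    HasDerivWithinAt (fun t => T t (φ t)) (T' (φ x) + T x φ') s x := by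
  rw [hasDerivWithinAt_iff_tendsto_slope]
  -- The difference is split as `(T t - T x) (φ x) + T t (φ t - φ x)`; in the second term both
  -- entries move, whence the joint sequential continuity.
  have h1 : Tendsto (fun t => T t (slope φ x t)) (𝓝[s \ {x}] x) (𝓝 (T x φ')) :=
    tendsto_apply_of_tendsto
      (fun ψ => (hT ψ).continuousWithinAt.tendsto.mono_left (nhdsWithin_mono _ sdiff_subset)) hφ
  have h2 := hasDerivWithinAt_iff_tendsto_slope.1 (hT (φ x))
  refine (h2.add h1).congr fun t => ?_
  have hs : ∀ (c : ℝ) (ψ : 𝓢(ℝ, ℂ)), T t (c • ψ) = c • T t ψ := fun c ψ =>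
    (T t : 𝓢(ℝ, ℂ) →L[ℂ] ℂ).map_smul_of_tower c ψ
  simp only [slope, vsub_eq_sub, hs, map_sub, ← smul_add]
  congr 1
  ring

end Derivative

/-! ### Functions of temperate growth: inverses, square roots, exponentials. -/

section TemperateGrowth

/-- `f` has at most polynomial growth. -/
def PolynomiallyBounded (f : ℝ → ℂ) : Prop := ∃ (k : ℕ) (C : ℝ), ∀ x, ‖f x‖ ≤ C * (1 + |x|) ^ k

theorem PolynomiallyBounded.mul {f g : ℝ → ℂ} (hf : PolynomiallyBounded f)
    (hg : PolynomiallyBounded g) : PolynomiallyBounded fun x => f x * g x := by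
  obtain ⟨k, C, hf⟩ := hf
  obtain ⟨l, D, hg⟩ := hg
  refine ⟨k + l, C * D, fun x => ?_⟩
  have h0 : 0 ≤ C * (1 + |x|) ^ k := (norm_nonneg _).trans (hf x)
  calc ‖f x * g x‖ = ‖f x‖ * ‖g x‖ := norm_mul _ _
    _ ≤ (C * (1 + |x|) ^ k) * (D * (1 + |x|) ^ l) := by
        gcongr
        · exact hf x
        · exact hg x
    _ = _ := by ring

theorem PolynomiallyBounded.pow {f : ℝ → ℂ} (hf : PolynomiallyBounded f) (m : ℕ) :
    PolynomiallyBounded fun x => f x ^ m := by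
  induction m with
  | zero => exact ⟨0, 1, fun x => by simp⟩
  | succ m ih => simpa only [pow_succ] using ih.mul hf

theorem _root_.Function.HasTemperateGrowth.polynomiallyBounded {f : ℝ → ℂ}
    (hf : f.HasTemperateGrowth) : PolynomiallyBounded f := by
  obtain ⟨k, C, h⟩ := hf.2 0
  exact ⟨k, C, fun x => by simpa using h x⟩

theorem _root_.Function.HasTemperateGrowth.differentiable {f : ℝ → ℂ}
    (hf : f.HasTemperateGrowth) : Differentiable ℝ f :=
  hf.1.differentiable (by simp)

theorem _root_.Function.HasTemperateGrowth.deriv {f : ℝ → ℂ}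
    (hf : f.HasTemperateGrowth) : (deriv f).HasTemperateGrowth := by
  refine ⟨(contDiff_infty_iff_deriv.1 hf.1).2, fun n => ?_⟩
  obtain ⟨k, C, h⟩ := hf.2 (n + 1)
  refine ⟨k, C, fun x => ?_⟩
  have := h x
  rwa [norm_iteratedFDeriv_eq_norm_iteratedDeriv, iteratedDeriv_succ',
    ← norm_iteratedFDeriv_eq_norm_iteratedDeriv] at this

/-- A class of polynomially bounded functions which is stable under differentiation consists of
functions of temperate growth. -/
theorem hasTemperateGrowth_of_deriv_mem {S : Set (ℝ → ℂ)}
    (hS : ∀ f ∈ S, PolynomiallyBounded f ∧ ∃ f' ∈ S, ∀ x, HasDerivAt f (f' x) x)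
    {f : ℝ → ℂ} (hf : f ∈ S) : f.HasTemperateGrowth := by
  have hiter : ∀ n, iteratedDeriv n f ∈ S := by
    intro n
    induction n with
    | zero => simpa using hf
    | succ n ih =>
      obtain ⟨-, g, hg, hd⟩ := hS _ ih
      rw [iteratedDeriv_succ, show deriv (iteratedDeriv n f) = g from funext fun x => (hd x).deriv]
      exact hg
  refine ⟨contDiff_of_differentiable_iteratedDeriv (n := ⊤) fun m _ => ?_, fun n => ?_⟩
  · obtain ⟨-, g, -, hd⟩ := hS _ (hiter m)
    exact fun x => (hd x).differentiableAt
  · obtain ⟨⟨k, C, h⟩, -⟩ := hS _ (hiter n)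
    refine ⟨k, C, fun x => ?_⟩
    rw [norm_iteratedFDeriv_eq_norm_iteratedDeriv]
    exact h x

/-- The functions `b * f⁻ᵐ` with `b` temperate form a class stable under differentiation. -/
theorem hasTemperateGrowth_inv {f : ℝ → ℂ} (hf : f.HasTemperateGrowth) (h0 : ∀ x, f x ≠ 0)
    (hb : PolynomiallyBounded fun x => (f x)⁻¹) :
    (fun x => (f x)⁻¹).HasTemperateGrowth := by
  refine hasTemperateGrowth_of_deriv_mem
    (S := {F | ∃ (b : ℝ → ℂ) (m : ℕ), b.HasTemperateGrowth ∧ F = fun x => b x * (f x)⁻¹ ^ m}) ?_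
    ⟨fun _ => 1, 1, .const 1, by simp⟩
  rintro _ ⟨b, m, hbt, rfl⟩
  refine ⟨hbt.polynomiallyBounded.mul (hb.pow m), _,
    ⟨fun x => deriv b x * f x - m * (b x * deriv f x), m + 1,
      (hbt.deriv.mul hf).sub ((Function.HasTemperateGrowth.const _).mul (hbt.mul hf.deriv)), rfl⟩,
    fun x => ?_⟩
  have h1 := ((hf.differentiable x).hasDerivAt.inv (h0 x)).pow m
  refine ((hbt.differentiable x).hasDerivAt.mul h1).congr_deriv ?_
  have := h0 x
  rcases m with _ | m
  · simp; field_simp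
  · simp; field_simp; ring

/-- The stable class is `b * s ^ (1 - m)` with `b` temperate: since `s' = z' / (2 s)` and `s ^ (1 -
m) = z * s ^ (-1 - m)`, the derivative is `(b' z + (1 - m) / 2 * b z') * s ^ (-1 - m)`, of the same
form with `m + 2`. -/
theorem hasTemperateGrowth_of_sq {s z : ℝ → ℂ} (hz : z.HasTemperateGrowth)
    (hsq : ∀ x, s x ^ 2 = z x) {c : ℝ} (hc : 0 < c) (hzc : ∀ x, c ≤ ‖z x‖)
    (hder : ∀ x, HasDerivAt s (deriv z x / (2 * s x)) x) : s.HasTemperateGrowth := by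
  have hns : ∀ x, ‖s x‖ ^ 2 = ‖z x‖ := fun x => by rw [← norm_pow, hsq]
  have h0 : ∀ x, s x ≠ 0 := fun x h => by
    have := hns x
    rw [h] at this
    simp at this
    linarith [hzc x, norm_eq_zero.2 this.symm]
  have hb1 : PolynomiallyBounded s := by
    obtain ⟨k, C, h⟩ := hz.polynomiallyBounded
    refine ⟨k, 1 + C, fun x => ?_⟩
    have h1 : (1 : ℝ) ≤ (1 + |x|) ^ k := one_le_pow₀ (by linarith [abs_nonneg x])
    nlinarith [h x, hns x, sq_nonneg (‖s x‖ - 1)]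
  have hb2 : PolynomiallyBounded fun x => (s x)⁻¹ := by
    refine ⟨0, 1 + c⁻¹, fun x => ?_⟩
    have h1 : ‖(s x)⁻¹‖ ^ 2 ≤ c⁻¹ := by
      rw [norm_inv, inv_pow, hns]
      exact inv_anti₀ hc (hzc x)
    nlinarith [sq_nonneg (‖(s x)⁻¹‖ - 1)]
  refine hasTemperateGrowth_of_deriv_mem
    (S := {F | ∃ (b : ℝ → ℂ) (m : ℕ), b.HasTemperateGrowth ∧
      F = fun x => b x * ((s x)⁻¹ ^ m * s x)}) ?_
    ⟨fun _ => 1, 0, .const 1, by simp⟩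
  rintro _ ⟨b, m, hbt, rfl⟩
  refine ⟨hbt.polynomiallyBounded.mul ((hb2.pow m).mul hb1), _,
    ⟨fun x => deriv b x * z x + (1 - m) / 2 * (b x * deriv z x), m + 2,
      (hbt.deriv.mul hz).add ((Function.HasTemperateGrowth.const _).mul (hbt.mul hz.deriv)), rfl⟩,
    fun x => ?_⟩
  have h1 := (((hder x).inv (h0 x)).pow m).mul (hder x)
  refine ((hbt.differentiable x).hasDerivAt.mul h1).congr_deriv ?_
  have := h0 x
  simp only [← hsq x]
  rcases m with _ | m
  · simp; field_simp
  · simp; field_simp; ring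

theorem sqrt_sq (z : ℂ) : Complex.sqrt z ^ 2 = z := by
  rw [Complex.sqrt, show (2⁻¹ : ℂ) = ((2 : ℕ) : ℂ)⁻¹ by norm_num,
    Complex.cpow_nat_inv_pow _ two_ne_zero]

theorem hasTemperateGrowth_sqrt {z : ℝ → ℂ} (hz : z.HasTemperateGrowth)
    (hs : ∀ x, z x ∈ Complex.slitPlane) {c : ℝ} (hc : 0 < c) (hzc : ∀ x, c ≤ ‖z x‖) :
    (fun x => Complex.sqrt (z x)).HasTemperateGrowth := by
  refine hasTemperateGrowth_of_sq hz (fun x => sqrt_sq _) hc hzc fun x => ?_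
  have h1 := (Complex.hasStrictDerivAt_cpow_const (c := (2⁻¹ : ℂ)) (hs x)).hasDerivAt
  refine (h1.comp x (hz.differentiable x).hasDerivAt).congr_deriv ?_
  have h2 : z x ^ ((2⁻¹ : ℂ) - 1) = (Complex.sqrt (z x))⁻¹ := by
    rw [Complex.sqrt, ← Complex.cpow_neg]
    norm_num
  rw [h2, div_eq_mul_inv, mul_inv]
  ring

/-- The exponential is bounded by one because `Re A ≤ 0`, and its multiples by temperate functions
are stable under differentiation. -/
theorem hasTemperateGrowth_cexp {A : ℝ → ℂ} (hA : A.HasTemperateGrowth)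
    (hre : ∀ x, (A x).re ≤ 0) {t : ℝ} (ht : 0 ≤ t) :
    (fun x => Complex.exp (A x * t)).HasTemperateGrowth := by
  refine hasTemperateGrowth_of_deriv_mem
    (S := {F | ∃ b : ℝ → ℂ, b.HasTemperateGrowth ∧ F = fun x => b x * Complex.exp (A x * t)}) ?_
    ⟨fun _ => 1, .const 1, by simp⟩
  rintro _ ⟨b, hb, rfl⟩
  refine ⟨hb.polynomiallyBounded.mul ⟨0, 1, fun x => ?_⟩, _,
    ⟨fun x => deriv b x + b x * deriv A x * t,
      hb.deriv.add ((hb.mul hA.deriv).mul (Function.HasTemperateGrowth.const _)), rfl⟩,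
    fun x => ?_⟩
  · rw [Complex.norm_exp]
    simpa using mul_nonpos_of_nonpos_of_nonneg (hre x) ht
  · have h1 := ((hA.differentiable x).hasDerivAt.mul_const (t : ℂ)).cexp
    refine ((hb.differentiable x).hasDerivAt.mul h1).congr_deriv ?_
    ring

end TemperateGrowth

/-! ### The dissipative semigroup `exp (A x)` on Schwartz functions. -/

section Semigroup

/-- Symbols of temperate growth whose real part is negative, with an inverse of temperate
growth. -/
structure IsDissipative (A : ℝ → ℂ) : Prop where
  temperate : A.HasTemperateGrowth
  re_neg : ∀ η, (A η).re < 0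
  inv_re : (fun η => (((A η).re : ℂ))⁻¹).HasTemperateGrowth

/-- Multiplication by `exp (A x)` on Schwartz functions. -/
noncomputable def expMul (A : ℝ → ℂ) (x : ℝ) : 𝓢(ℝ, ℂ) →L[ℂ] 𝓢(ℝ, ℂ) :=
  SchwartzMap.smulLeftCLM ℂ fun η => Complex.exp (A η * x)

theorem smulLeft_apply {f : ℝ → ℂ} (hf : f.HasTemperateGrowth) (φ : 𝓢(ℝ, ℂ)) (η : ℝ) :
    SchwartzMap.smulLeftCLM ℂ f φ η = f η * φ η :=
  SchwartzMap.smulLeftCLM_apply_apply hf φ η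

variable {A : ℝ → ℂ}

theorem IsDissipative.temperate_cexp (hA : IsDissipative A) {x : ℝ} (hx : 0 ≤ x) :
    (fun η => Complex.exp (A η * x)).HasTemperateGrowth :=
  hasTemperateGrowth_cexp hA.temperate (fun η => (hA.re_neg η).le) hx

theorem expMul_apply (hA : IsDissipative A) {x : ℝ} (hx : 0 ≤ x) (φ : 𝓢(ℝ, ℂ)) (η : ℝ) :
    expMul A x φ η = Complex.exp (A η * x) * φ η :=
  smulLeft_apply (hA.temperate_cexp hx) φ η

theorem expMul_zero (hA : IsDissipative A) (φ : 𝓢(ℝ, ℂ)) : expMul A 0 φ = φ := by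
  ext η
  simp [expMul_apply hA le_rfl]

theorem expMul_expMul (hA : IsDissipative A) {x y : ℝ} (hx : 0 ≤ x) (hy : 0 ≤ y) (φ : 𝓢(ℝ, ℂ)) :
    expMul A x (expMul A y φ) = expMul A (x + y) φ := by
  ext η
  rw [expMul_apply hA hx, expMul_apply hA hy, expMul_apply hA (add_nonneg hx hy), ← mul_assoc,
    ← Complex.exp_add]
  push_cast
  ring_nf

theorem smulLeft_expMul (hA : IsDissipative A) {f : ℝ → ℂ} (hf : f.HasTemperateGrowth) {x : ℝ}
    (hx : 0 ≤ x) (φ : 𝓢(ℝ, ℂ)) :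
    SchwartzMap.smulLeftCLM ℂ f (expMul A x φ) =
      expMul A x (SchwartzMap.smulLeftCLM ℂ f φ) := by
  ext η
  rw [smulLeft_apply hf, expMul_apply hA hx, expMul_apply hA hx, smulLeft_apply hf]
  ring

theorem derivCLM_smulLeft {f : ℝ → ℂ} (hf : f.HasTemperateGrowth) (φ : 𝓢(ℝ, ℂ)) :
    SchwartzMap.derivCLM ℂ ℂ (SchwartzMap.smulLeftCLM ℂ f φ) =
      SchwartzMap.smulLeftCLM ℂ f (SchwartzMap.derivCLM ℂ ℂ φ) +
        SchwartzMap.smulLeftCLM ℂ (deriv f) φ := by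
  ext η
  rw [SchwartzMap.derivCLM_apply, add_apply, smulLeft_apply hf,
    smulLeft_apply hf.deriv, SchwartzMap.derivCLM_apply,
    show ⇑(SchwartzMap.smulLeftCLM ℂ f φ) = fun x => f x * φ x from
      funext fun x => smulLeft_apply hf φ x]
  rw [((hf.differentiable η).hasDerivAt.fun_mul (φ.hasDerivAt η)).deriv]
  ring

theorem derivCLM_expMul (hA : IsDissipative A) {x : ℝ} (hx : 0 ≤ x) (φ : 𝓢(ℝ, ℂ)) :
    SchwartzMap.derivCLM ℂ ℂ (expMul A x φ) =
      expMul A x (SchwartzMap.derivCLM ℂ ℂ φ) +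
        (x : ℂ) • expMul A x (SchwartzMap.smulLeftCLM ℂ (deriv A) φ) := by
  have h1 := derivCLM_smulLeft (hA.temperate_cexp hx) φ
  rw [expMul, h1]
  congr 1
  ext η
  rw [smulLeft_apply (hA.temperate_cexp hx).deriv, smul_apply,
    smulLeft_apply (hA.temperate_cexp hx), smulLeft_apply hA.temperate.deriv,
    (((hA.temperate.differentiable η).hasDerivAt.mul_const (x : ℂ)).cexp).deriv, smul_eq_mul]
  ring

theorem pow_mul_exp_neg_le (K : ℕ) {t : ℝ} (ht : 0 ≤ t) :
    t ^ K * Real.exp (-t) ≤ K.factorial := by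
  have h := Real.pow_div_factorial_le_exp t ht K
  rw [div_le_iff₀ (by positivity)] at h
  rw [Real.exp_neg, ← div_eq_mul_inv, div_le_iff₀ (Real.exp_pos t)]
  linarith

/-- For `n = 0`, `x ^ K * exp (x Re A) ≤ K! * |Re A| ^ (-K)`, and the last factor is temperate, so
`φ` absorbs it. Each derivative in `η` brings down `x A'`, at the cost of one power of `x`; hence
the induction on `n` runs over all `K` and `φ` at once. -/
theorem exists_pow_mul_seminorm_expMul_le (hA : IsDissipative A) (n k K : ℕ) (φ : 𝓢(ℝ, ℂ)) :
    ∃ C : ℝ, ∀ x : ℝ, 0 ≤ x → x ^ K * SchwartzMap.seminorm ℂ k n (expMul A x φ) ≤ C := by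
  induction n generalizing K φ with
  | zero =>
    have hp := hA.inv_re.pow K
    refine ⟨K.factorial * SchwartzMap.seminorm ℂ k 0
      (SchwartzMap.smulLeftCLM ℂ ((fun η => (((A η).re : ℂ))⁻¹) ^ K) φ), fun x hx => ?_⟩
    rw [← abs_of_nonneg (pow_nonneg hx K), ← Real.norm_eq_abs, ← Complex.norm_real,
      ← map_smul_eq_mul (SchwartzMap.seminorm ℂ k 0)]
    refine seminorm_zero_le_bound k _ (by positivity) fun η => ?_
    have h := le_seminorm_zero k (SchwartzMap.smulLeftCLM ℂ ((fun η => (((A η).re : ℂ))⁻¹) ^ K) φ) η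
    rw [smulLeft_apply hp] at h
    rw [smul_apply, expMul_apply hA hx]
    have hr : 0 < -(A η).re := by linarith [hA.re_neg η]
    have hE := pow_mul_exp_neg_le K (mul_nonneg hr.le hx)
    simp only [norm_mul, smul_eq_mul, Pi.pow_apply, norm_pow, norm_inv, Complex.norm_real,
      Complex.norm_exp, Real.norm_eq_abs, Complex.mul_re, Complex.ofReal_re, Complex.ofReal_im,
      mul_zero, sub_zero, abs_of_nonneg hx, abs_of_neg (hA.re_neg η), Complex.ofReal_pow] at h ⊢
    calc |η| ^ k * (x ^ K * (Real.exp ((A η).re * x) * ‖φ η‖))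
        = ((-(A η).re * x) ^ K * Real.exp (-(-(A η).re * x))) *
            (|η| ^ k * (((-(A η).re)⁻¹) ^ K * ‖φ η‖)) := by
          rw [mul_pow, inv_pow]
          field_simp
      _ ≤ _ := by gcongr
  | succ n ih =>
    obtain ⟨C, hC⟩ := ih K (SchwartzMap.derivCLM ℂ ℂ φ)
    obtain ⟨D, hD⟩ := ih (K + 1) (SchwartzMap.smulLeftCLM ℂ (deriv A) φ)
    refine ⟨C + D, fun x hx => ?_⟩
    rw [seminorm_succ, derivCLM_expMul hA hx]
    have h1 := map_add_le_add (SchwartzMap.seminorm ℂ k n)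
      (expMul A x (SchwartzMap.derivCLM ℂ ℂ φ))
      ((x : ℂ) • expMul A x (SchwartzMap.smulLeftCLM ℂ (deriv A) φ))
    rw [map_smul_eq_mul, Complex.norm_real, Real.norm_of_nonneg hx] at h1
    have h2 := hC x hx
    have h3 := hD x hx
    rw [pow_succ] at h3
    refine (mul_le_mul_of_nonneg_left h1 (pow_nonneg hx K)).trans ?_
    linarith

theorem norm_cexp_sub_le {a : ℂ} (ha : a.re ≤ 0) {x y : ℝ} (hx : 0 ≤ x) (hy : 0 ≤ y) :
    ‖Complex.exp (a * y) - Complex.exp (a * x)‖ ≤ ‖a‖ * |y - x| := by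
  refine Convex.norm_image_sub_le_of_norm_hasDerivWithin_le (s := Ici 0)
    (f := fun t : ℝ => Complex.exp (a * t)) (f' := fun t => Complex.exp (a * t) * a)
    (fun t _ => ?_) (fun t ht => ?_) (convex_Ici 0) hx hy
  · have h := ((Complex.ofRealCLM.hasDerivAt (x := t)).const_mul a).cexp
    simpa using h.hasDerivWithinAt
  · rw [norm_mul, Complex.norm_exp]
    refine mul_le_of_le_one_left (norm_nonneg _) (Real.exp_le_one_iff.2 ?_)
    simpa using mul_nonpos_of_nonpos_of_nonneg ha ht

theorem norm_cexp_sub_sub_le {a : ℂ} (ha : a.re ≤ 0) {x y : ℝ} (hx : 0 ≤ x) (hy : 0 ≤ y) :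
    ‖Complex.exp (a * y) - Complex.exp (a * x) - (y - x) * (Complex.exp (a * x) * a)‖ ≤
      ‖a‖ ^ 2 * (y - x) ^ 2 := by
  have h := Convex.norm_image_sub_le_of_norm_hasDerivWithin_le (s := uIcc x y)
    (f := fun t : ℝ => Complex.exp (a * t) - t * (Complex.exp (a * x) * a))
    (f' := fun t => Complex.exp (a * t) * a - Complex.exp (a * x) * a)
    (C := ‖a‖ ^ 2 * |y - x|)
    (fun t _ => ?_) (fun t ht => ?_) (convex_uIcc x y) left_mem_uIcc right_mem_uIcc
  · rw [Real.norm_eq_abs] at h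
    calc _ ≤ ‖a‖ ^ 2 * |y - x| * |y - x| := by
          refine le_of_eq_of_le (congrArg _ ?_) h
          ring
      _ = _ := by rw [mul_assoc, ← sq, sq_abs]
  · have h := ((Complex.ofRealCLM.hasDerivAt (x := t)).const_mul a).cexp
    have h2 := (Complex.ofRealCLM.hasDerivAt (x := t)).mul_const (Complex.exp (a * x) * a)
    simpa using (h.fun_sub h2).hasDerivWithinAt
  · have ht0 : 0 ≤ t := (le_min hx hy).trans ht.1
    rw [← sub_mul, norm_mul]
    have h1 := norm_cexp_sub_le ha hx ht0
    have h2 : |t - x| ≤ |y - x| := abs_sub_left_of_mem_uIcc ht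
    calc _ ≤ ‖a‖ * |t - x| * ‖a‖ := by gcongr
      _ ≤ ‖a‖ * |y - x| * ‖a‖ := by gcongr
      _ = _ := by ring

theorem exists_seminorm_expMul_sub_sub_le (hA : IsDissipative A) (M : ℝ) (n k : ℕ)
    (φ : 𝓢(ℝ, ℂ)) :
    ∃ C : ℝ, 0 ≤ C ∧ ∀ x ∈ Icc 0 M, ∀ y ∈ Icc 0 M, SchwartzMap.seminorm ℂ k n
      (expMul A y φ - expMul A x φ -
        ((y - x : ℝ) : ℂ) • expMul A x (SchwartzMap.smulLeftCLM ℂ A φ)) ≤ C * (y - x) ^ 2 := by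
  induction n generalizing φ with
  | zero =>
    refine ⟨SchwartzMap.seminorm ℂ k 0 (SchwartzMap.smulLeftCLM ℂ (A ^ 2) φ), apply_nonneg _ _,
      fun x hx y hy => ?_⟩
    refine seminorm_zero_le_bound k _ (by positivity) fun η => ?_
    have h := le_seminorm_zero k (SchwartzMap.smulLeftCLM ℂ (A ^ 2) φ) η
    have h2 := norm_cexp_sub_sub_le (hA.re_neg η).le hx.1 hy.1
    rw [smulLeft_apply (hA.temperate.pow 2)] at h
    simp only [sub_apply, smul_apply, expMul_apply hA hx.1,
      expMul_apply hA hy.1, smulLeft_apply hA.temperate, smul_eq_mul]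
    calc _ = |η| ^ k * (‖Complex.exp (A η * y) - Complex.exp (A η * x)
          - (y - x) * (Complex.exp (A η * x) * A η)‖ * ‖φ η‖) := by
          rw [← norm_mul]
          push_cast
          ring_nf
      _ ≤ |η| ^ k * (‖A η‖ ^ 2 * (y - x) ^ 2 * ‖φ η‖) := by gcongr
      _ = (|η| ^ k * ‖(A ^ 2) η * φ η‖) * (y - x) ^ 2 := by
          rw [norm_mul, Pi.pow_apply, norm_pow]; ring
      _ ≤ _ := by gcongr
  | succ n ih =>
    set ψ := SchwartzMap.smulLeftCLM ℂ (deriv A) φ with hψ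
    obtain ⟨C₁, hC₁, h₁⟩ := ih (SchwartzMap.derivCLM ℂ ℂ φ)
    obtain ⟨C₂, hC₂, h₂⟩ := ih ψ
    obtain ⟨C₃, h₃⟩ := exists_pow_mul_seminorm_expMul_le hA n k 0 (SchwartzMap.smulLeftCLM ℂ A ψ)
    refine ⟨C₁ + |M| * C₂ + (2 * |M| * C₂ + |C₃|), by positivity, fun x hx y hy => ?_⟩
    -- The derivative of the first-order Taylor remainder at `φ` is the remainder at `φ'`, plus `y`
    -- times the remainder at `ψ = A' φ`, plus an explicit term already quadratic in `y - x`. The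
    -- induction therefore closes; the summand `2 * |M| * C₂` in the constant is slack.
    have e : SchwartzMap.derivCLM ℂ ℂ (expMul A y φ - expMul A x φ -
        ((y - x : ℝ) : ℂ) • expMul A x (SchwartzMap.smulLeftCLM ℂ A φ)) =
      (expMul A y (SchwartzMap.derivCLM ℂ ℂ φ) - expMul A x (SchwartzMap.derivCLM ℂ ℂ φ) -
        ((y - x : ℝ) : ℂ) • expMul A x
          (SchwartzMap.smulLeftCLM ℂ A (SchwartzMap.derivCLM ℂ ℂ φ))) +
      (y : ℂ) • (expMul A y ψ - expMul A x ψ -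
        ((y - x : ℝ) : ℂ) • expMul A x (SchwartzMap.smulLeftCLM ℂ A ψ)) +
      (((y - x) ^ 2 : ℝ) : ℂ) • expMul A x (SchwartzMap.smulLeftCLM ℂ A ψ) := by
      simp only [map_sub, map_smul, derivCLM_expMul hA hx.1, derivCLM_expMul hA hy.1,
        derivCLM_smulLeft hA.temperate, map_add]
      have hcomm : SchwartzMap.smulLeftCLM ℂ (deriv A) (SchwartzMap.smulLeftCLM ℂ A φ) =
          SchwartzMap.smulLeftCLM ℂ A ψ := by
        ext η
        rw [hψ, smulLeft_apply hA.temperate.deriv, smulLeft_apply hA.temperate,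
          smulLeft_apply hA.temperate, smulLeft_apply hA.temperate.deriv]
        ring
      rw [hcomm, ← hψ]
      push_cast
      module
    rw [seminorm_succ, e]
    have hM : |y| ≤ |M| := by
      rw [abs_of_nonneg hy.1, abs_of_nonneg (hy.1.trans hy.2)]; exact hy.2
    refine (map_add_le_add _ _ _).trans ((add_le_add_left (map_add_le_add _ _ _) _).trans ?_)
    have h3 := h₃ x hx.1
    rw [pow_zero, one_mul] at h3
    have h4 : 0 ≤ 2 * |M| * C₂ * (y - x) ^ 2 := by positivity
    rw [map_smul_eq_mul, map_smul_eq_mul, Complex.norm_real, Complex.norm_real,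
      Real.norm_of_nonneg (sq_nonneg (y - x)), Real.norm_eq_abs]
    calc _ ≤ C₁ * (y - x) ^ 2 + |M| * (C₂ * (y - x) ^ 2) + (y - x) ^ 2 * |C₃| := by
          gcongr
          · exact h₁ x hx y hy
          · exact h₂ x hx y hy
          · exact h3.trans (le_abs_self _)
      _ ≤ _ := by nlinarith

/-- `x ↦ exp (A x) φ` is differentiable as a map into the Schwartz space. -/
theorem tendsto_slope_expMul (hA : IsDissipative A) {x : ℝ} (hx : 0 ≤ x) (φ : 𝓢(ℝ, ℂ)) :
    Tendsto (slope (fun t => expMul A t φ) x) (𝓝[Ici 0 \ {x}] x)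
      (𝓝 (expMul A x (SchwartzMap.smulLeftCLM ℂ A φ))) := by
  refine ((schwartz_withSeminorms ℂ ℝ ℂ).tendsto_nhds _ _).2 ?_
  rintro ⟨k, n⟩ ε hε
  obtain ⟨C, hC, h⟩ := exists_seminorm_expMul_sub_sub_le hA (x + 1) n k φ
  have hlim : Tendsto (fun y => C * |y - x|) (𝓝[Ici 0 \ {x}] x) (𝓝 0) := by
    have : Continuous fun y => C * |y - x| := by fun_prop
    exact (this.tendsto' x 0 (by simp)).mono_left nhdsWithin_le_nhds
  have hlt : ∀ᶠ y in 𝓝[Ici 0 \ {x}] x, y < x + 1 :=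
    nhdsWithin_le_nhds (gt_mem_nhds (lt_add_one x))
  filter_upwards [hlim.eventually (gt_mem_nhds hε), hlt, self_mem_nhdsWithin] with y hy hy1 hy2
  refine lt_of_le_of_lt ?_ hy
  have hne : y - x ≠ 0 := sub_ne_zero.2 hy2.2
  have h1 := h x ⟨hx, (lt_add_one x).le⟩ y ⟨hy2.1, hy1.le⟩
  have e : slope (fun t => expMul A t φ) x y - expMul A x (SchwartzMap.smulLeftCLM ℂ A φ) =
      (((y - x)⁻¹ : ℝ) : ℂ) • (expMul A y φ - expMul A x φ -
        ((y - x : ℝ) : ℂ) • expMul A x (SchwartzMap.smulLeftCLM ℂ A φ)) := by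
    ext η
    have : ((y : ℂ) - x) ≠ 0 := by exact_mod_cast hne
    simp [slope]
    field_simp
  change SchwartzMap.seminorm ℂ k n _ ≤ _
  rw [e, map_smul_eq_mul, Complex.norm_real, norm_inv, Real.norm_eq_abs]
  calc _ ≤ |y - x|⁻¹ * (C * (y - x) ^ 2) := by gcongr
    _ = C * |y - x| := by
      rw [← sq_abs]
      have : |y - x| ≠ 0 := abs_ne_zero.2 hne
      field_simp

theorem tendsto_slope_expMul_sub (hA : IsDissipative A) {b x : ℝ} (hx : x ≤ b) (φ : 𝓢(ℝ, ℂ)) :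
    Tendsto (slope (fun t => expMul A (b - t) φ) x) (𝓝[Iic b \ {x}] x)
      (𝓝 (-expMul A (b - x) (SchwartzMap.smulLeftCLM ℂ A φ))) := by
  have h := tendsto_slope_expMul hA (sub_nonneg.2 hx) φ
  have hmap : Tendsto (fun t => b - t) (𝓝[Iic b \ {x}] x) (𝓝[Ici 0 \ {b - x}] (b - x)) := by
    refine tendsto_nhdsWithin_of_tendsto_nhds_of_eventually_within _ ?_ ?_
    · exact ((continuous_const.sub continuous_id).tendsto x).mono_left nhdsWithin_le_nhds
    · filter_upwards [self_mem_nhdsWithin] with t ht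
      exact ⟨mem_Ici.2 (sub_nonneg.2 (mem_Iic.1 ht.1)), fun h => ht.2 (by simpa using h)⟩
  refine (h.comp hmap).neg.congr fun t => ?_
  simp only [Function.comp_apply, slope, vsub_eq_sub, ← neg_smul, ← inv_neg]
  congr 2
  ring

end Semigroup

/-! ### The characteristic exponents and the amplitude. -/

section Symbols

variable {ε ν kx ky : ℝ}

/-- The radicand `1 - 2εk_yη/k_x² + 2iνεk_y²/k_x²`. -/
noncomputable def radicand (ε ν kx ky η : ℝ) : ℂ :=
  1 - 2 * ((ε : ℂ) * ky * η / (kx : ℂ) ^ 2)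
    + 2 * Complex.I * ν * ((ε : ℂ) * (ky : ℂ) ^ 2 / (kx : ℂ) ^ 2)

theorem radicand_im (η : ℝ) :
    (radicand ε ν kx ky η).im = 2 * ν * (ε * ky ^ 2 / kx ^ 2) := by
  have h : radicand ε ν kx ky η = ((1 - 2 * (ε * ky * η / kx ^ 2) : ℝ) : ℂ) +
      ((2 * ν * (ε * ky ^ 2 / kx ^ 2) : ℝ) : ℂ) * Complex.I := by
    rw [radicand]; push_cast; ring
  rw [h, Complex.add_im, Complex.ofReal_im, Complex.im_ofReal_mul, Complex.I_im, zero_add, mul_one]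

theorem radicand_im_pos (hε : 0 < ε) (hν : 0 < ν) (hkx : 0 < kx) (hky : ky ≠ 0) :
    0 < 2 * ν * (ε * ky ^ 2 / kx ^ 2) := by
  have : 0 < ky ^ 2 := by positivity
  positivity

theorem root_sq (η : ℝ) : root ε ν kx ky η ^ 2 = radicand ε ν kx ky η := sqrt_sq _

theorem temperate_root (hε : 0 < ε) (hν : 0 < ν) (hkx : 0 < kx) (hky : ky ≠ 0) :
    (root ε ν kx ky).HasTemperateGrowth := by
  have hc := radicand_im_pos hε hν hkx hky
  have hz : (radicand ε ν kx ky).HasTemperateGrowth := by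
    have h : radicand ε ν kx ky = fun η : ℝ => (1 + 2 * Complex.I * ν *
        ((ε : ℂ) * (ky : ℂ) ^ 2 / (kx : ℂ) ^ 2)) + (-(2 * (ε * ky / (kx : ℂ) ^ 2))) * (η : ℂ) := by
      ext η
      rw [radicand]
      ring
    rw [h]
    exact (Function.HasTemperateGrowth.const _).add
      ((Function.HasTemperateGrowth.const _).mul Function.Complex.hasTemperateGrowth_ofReal)
  refine hasTemperateGrowth_sqrt (z := radicand ε ν kx ky) hz (fun η => ?_) hc fun η => ?_
  · exact Or.inr (by rw [radicand_im]; exact hc.ne')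
  · rw [← radicand_im (kx := kx) (ky := ky) η]
    exact (le_abs_self _).trans (Complex.abs_im_le_norm _)

theorem root_re_nonneg (η : ℝ) : 0 ≤ (root ε ν kx ky η).re := by
  rw [root, Complex.sqrt, Complex.cpow_inv_two_re]
  exact Real.sqrt_nonneg _

/-- This is the imaginary part of `root ^ 2 = radicand`, and its independence of `η` is decisive: it
forces the imaginary part of the root to be positive and makes its inverse a constant multiple of
the real part. -/
theorem root_re_mul_im (η : ℝ) :
    2 * (root ε ν kx ky η).re * (root ε ν kx ky η).im = 2 * ν * (ε * ky ^ 2 / kx ^ 2) := by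
  rw [← radicand_im (kx := kx) (ky := ky) η, ← root_sq, sq, Complex.mul_im]
  ring

theorem root_im_pos (hε : 0 < ε) (hν : 0 < ν) (hkx : 0 < kx) (hky : ky ≠ 0) (η : ℝ) :
    0 < (root ε ν kx ky η).im := by
  have h := radicand_im_pos hε hν hkx hky
  rw [← root_re_mul_im η] at h
  exact pos_of_mul_pos_right h (by linarith [root_re_nonneg (ε := ε) (ν := ν) (kx := kx) (ky := ky) η])

theorem one_add_root_ne_zero (η : ℝ) : 1 + root ε ν kx ky η ≠ 0 := fun h => by
  have := congrArg Complex.re h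
  simp at this
  linarith [root_re_nonneg (ε := ε) (ν := ν) (kx := kx) (ky := ky) η]

/-- The conjugate exponent `R_+(iη) = i k_x η / k_y - i k_x / (ε k_y²) (1 + √(…))`, up to sign. -/
noncomputable def negRplus (ε ν kx ky η : ℝ) : ℂ :=
  -(Complex.I * ((kx : ℂ) * η / ky)
    - Complex.I * ((kx : ℂ) / ((ε : ℂ) * (ky : ℂ) ^ 2)) * (1 + root ε ν kx ky η))

/-- Apart from `i kx / (ε ky²)` times the root, all terms are purely imaginary. The same root term,
with the same sign, occurs in `negRplus`, so both symbols have the same real part. -/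
theorem Rminus_re (η : ℝ) :
    (Rminus ε ν kx ky η).re = -(kx / (ε * ky ^ 2)) * (root ε ν kx ky η).im := by
  have h : Rminus ε ν kx ky η = Complex.I * ((kx * η / ky : ℝ) : ℂ)
    - Complex.I * (((kx / (ε * ky ^ 2) : ℝ) : ℂ) * (1 - root ε ν kx ky η)) := by
    rw [Rminus]; push_cast; ring
  rw [h, Complex.sub_re, Complex.I_mul_re, Complex.I_mul_re, Complex.ofReal_im,
    Complex.im_ofReal_mul]
  simp

theorem negRplus_re (η : ℝ) :
    (negRplus ε ν kx ky η).re = -(kx / (ε * ky ^ 2)) * (root ε ν kx ky η).im := by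
  have h : negRplus ε ν kx ky η = Complex.I * (((kx / (ε * ky ^ 2) : ℝ) : ℂ) *
      (1 + root ε ν kx ky η)) - Complex.I * ((kx * η / ky : ℝ) : ℂ) := by
    rw [negRplus]; push_cast; ring
  rw [h, Complex.sub_re, Complex.I_mul_re, Complex.I_mul_re, Complex.ofReal_im,
    Complex.im_ofReal_mul]
  simp

theorem isDissipative_of_re (hε : 0 < ε) (hν : 0 < ν) (hkx : 0 < kx) (hky : ky ≠ 0) {A : ℝ → ℂ}
    (hA : A.HasTemperateGrowth)
    (hre : ∀ η, (A η).re = -(kx / (ε * ky ^ 2)) * (root ε ν kx ky η).im) : IsDissipative A := by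
  have hc := radicand_im_pos hε hν hkx hky
  have hpos : 0 < kx / (ε * ky ^ 2) := by positivity
  refine ⟨hA, fun η => ?_, ?_⟩
  · rw [hre, neg_mul, neg_lt_zero]
    exact mul_pos hpos (root_im_pos hε hν hkx hky η)
  -- By `root_re_mul_im`, `1 / Im root` equals `2 Re root` divided by the constant imaginary part of
  -- the radicand.
  · have h : (fun η => (((A η).re : ℂ))⁻¹) = fun η =>
        ((-(kx / (ε * ky ^ 2))⁻¹ * 2 / (2 * ν * (ε * ky ^ 2 / kx ^ 2)) : ℝ) : ℂ) *
          ((root ε ν kx ky η).re : ℂ) := by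
      ext η
      have h1 := root_im_pos hε hν hkx hky η
      rw [hre, ← root_re_mul_im η, ← Complex.ofReal_inv, ← Complex.ofReal_mul]
      congr 1
      have h2 : (root ε ν kx ky η).re ≠ 0 := fun h => by
        have := root_re_mul_im (ε := ε) (ν := ν) (kx := kx) (ky := ky) η
        rw [h] at this
        simp only [mul_zero, zero_mul] at this
        exact hc.ne this
      have := hpos.ne'
      field_simp
    rw [h]
    exact (Function.HasTemperateGrowth.const _).mul
      (Function.Complex.hasTemperateGrowth_ofReal.comp
        (Complex.reCLM.hasTemperateGrowth.comp (temperate_root hε hν hkx hky)))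

theorem temperate_affine (a b : ℂ) : (fun η : ℝ => a + b * (η : ℂ)).HasTemperateGrowth :=
  (Function.HasTemperateGrowth.const _).add
    ((Function.HasTemperateGrowth.const _).mul Function.Complex.hasTemperateGrowth_ofReal)

theorem isDissipative_Rminus (hε : 0 < ε) (hν : 0 < ν) (hkx : 0 < kx) (hky : ky ≠ 0) :
    IsDissipative (Rminus ε ν kx ky) := by
  refine isDissipative_of_re hε hν hkx hky ?_ Rminus_re
  have h : Rminus ε ν kx ky = fun η : ℝ => (-(Complex.I * ((kx : ℂ) / ((ε : ℂ) * (ky : ℂ) ^ 2))) +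
      Complex.I * (kx / ky) * (η : ℂ)) +
      Complex.I * ((kx : ℂ) / ((ε : ℂ) * (ky : ℂ) ^ 2)) * root ε ν kx ky η := by
    ext η
    rw [Rminus]
    ring
  rw [h]
  exact (temperate_affine _ _).add
    ((Function.HasTemperateGrowth.const _).mul (temperate_root hε hν hkx hky))

theorem isDissipative_negRplus (hε : 0 < ε) (hν : 0 < ν) (hkx : 0 < kx) (hky : ky ≠ 0) :
    IsDissipative (negRplus ε ν kx ky) := by
  refine isDissipative_of_re hε hν hkx hky ?_ negRplus_re
  have h : negRplus ε ν kx ky = fun η : ℝ =>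
      (Complex.I * ((kx : ℂ) / ((ε : ℂ) * (ky : ℂ) ^ 2)) +
      (-(Complex.I * (kx / ky))) * (η : ℂ)) +
      Complex.I * ((kx : ℂ) / ((ε : ℂ) * (ky : ℂ) ^ 2)) * root ε ν kx ky η := by
    ext η
    rw [negRplus]
    ring
  rw [h]
  exact (temperate_affine _ _).add
    ((Function.HasTemperateGrowth.const _).mul (temperate_root hε hν hkx hky))

/-- The amplitude `2 / (1 + √(…))`. -/
noncomputable def amplitude (ε ν kx ky η : ℝ) : ℂ := 2 / (1 + root ε ν kx ky η)

theorem temperate_amplitude (hε : 0 < ε) (hν : 0 < ν) (hkx : 0 < kx) (hky : ky ≠ 0) :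
    (amplitude ε ν kx ky).HasTemperateGrowth := by
  have h : amplitude ε ν kx ky = fun η => 2 * (1 + root ε ν kx ky η)⁻¹ :=
    funext fun η => div_eq_mul_inv _ _
  rw [h]
  refine (Function.HasTemperateGrowth.const _).mul (hasTemperateGrowth_inv
    ((Function.HasTemperateGrowth.const _).add (temperate_root hε hν hkx hky))
    one_add_root_ne_zero ⟨0, 1, fun η => ?_⟩)
  rw [norm_inv, pow_zero, one_mul]
  -- The principal root has nonnegative real part, so `|1 + root| ≥ 1`.
  refine inv_le_one_of_one_le₀ ?_
  have h1 := Complex.re_le_norm (1 + root ε ν kx ky η)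
  rw [Complex.add_re, Complex.one_re] at h1
  linarith [root_re_nonneg (ε := ε) (ν := ν) (kx := kx) (ky := ky) η]

theorem amplitude_mul (η : ℝ) : amplitude ε ν kx ky η * (1 + root ε ν kx ky η) = 2 :=
  div_mul_cancel₀ _ (one_add_root_ne_zero η)

/-- The product of the two exponents. -/
theorem coeff_zero_eq (hε : 0 < ε) (hkx : 0 < kx) (hky : ky ≠ 0) (hk : kx ^ 2 + ky ^ 2 = 1)
    (η : ℝ) :
    -(ky * η : ℂ) - ε / 2 * (kx : ℂ) ^ 2 * (η : ℂ) ^ 2 + Complex.I * ν =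
      -((ε : ℂ) / 2 * (ky : ℂ) ^ 2) * (Rminus ε ν kx ky η * negRplus ε ν kx ky η) := by
  have h := root_sq (ε := ε) (ν := ν) (kx := kx) (ky := ky) η
  have h1 : (ε : ℂ) ≠ 0 := by exact_mod_cast hε.ne'
  have h2 : (kx : ℂ) ≠ 0 := by exact_mod_cast hkx.ne'
  have h3 : (ky : ℂ) ≠ 0 := by exact_mod_cast hky
  rw [Rminus, negRplus]
  rw [radicand] at h
  set s := root ε ν kx ky η
  have e : -((ε : ℂ) / 2 * (ky : ℂ) ^ 2) * ((Complex.I * ((kx : ℂ) * η / ky)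
    - Complex.I * ((kx : ℂ) / ((ε : ℂ) * (ky : ℂ) ^ 2)) * (1 - s)) * (-(Complex.I * ((kx : ℂ) * η / ky)
    - Complex.I * ((kx : ℂ) / ((ε : ℂ) * (ky : ℂ) ^ 2)) * (1 + s)))) =
      ((ε : ℂ) / 2 * (ky : ℂ) ^ 2) * Complex.I ^ 2 *
      (((kx : ℂ) * η / ky - (kx : ℂ) / ((ε : ℂ) * (ky : ℂ) ^ 2)) ^ 2 -
        ((kx : ℂ) / ((ε : ℂ) * (ky : ℂ) ^ 2)) ^ 2 * s ^ 2) := by ring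
  have hk' : (kx : ℂ) ^ 2 + (ky : ℂ) ^ 2 = 1 := by exact_mod_cast hk
  rw [e, h, Complex.I_sq]
  field_simp
  -- The terms linear in `η` combine to a multiple of `1 - kx²`, which is `ky²` because the vector
  -- is a unit vector.
  linear_combination (-2 * ky * ε * η : ℂ) * hk'

/-- The sum of the two exponents. -/
theorem coeff_one_eq (hε : 0 < ε) (hky : ky ≠ 0) (η : ℝ) :
    Complex.I * (kx - ε * kx * ky * η : ℂ) =
      -((ε : ℂ) / 2 * (ky : ℂ) ^ 2) * (Rminus ε ν kx ky η - negRplus ε ν kx ky η) := by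
  have h1 : (ε : ℂ) ≠ 0 := by exact_mod_cast hε.ne'
  have h3 : (ky : ℂ) ≠ 0 := by exact_mod_cast hky
  rw [Rminus, negRplus]
  field_simp
  ring

/-- The left side is the symbol of the entrance operator once `∂ₓ` is replaced by `R₋`. As `1 +
root` never vanishes, the entrance condition can be solved for the trace at `x = 0`. -/
theorem entrance_coeff_eq (hε : 0 < ε) (hky : ky ≠ 0) (η : ℝ) :
    (2 * kx - ε * kx * ky * η : ℂ) - Complex.I * ε * (ky : ℂ) ^ 2 * Rminus ε ν kx ky η =
      kx * (1 + root ε ν kx ky η) := by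
  have h1 : (ε : ℂ) ≠ 0 := by exact_mod_cast hε.ne'
  have h3 : (ky : ℂ) ≠ 0 := by exact_mod_cast hky
  rw [Rminus]
  have h := Complex.I_sq
  field_simp
  linear_combination (kx - kx * root ε ν kx ky η - ε * kx * ky * η : ℂ) * h

end Symbols

/-! ### The equation and the entrance condition on the Fourier side. -/

section Fourier

/-- The inverse of `fourierSchwartz`. -/
noncomputable def fourierSchwartzInv : 𝓢(ℝ, ℂ) →L[ℂ] 𝓢(ℝ, ℂ) :=
  (fourierInvCLM ℂ 𝓢(ℝ, ℂ)).comp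
    (SchwartzMap.compCLMOfContinuousLinearEquiv ℂ
      (ContinuousLinearEquiv.unitsEquivAut ℝ (Units.mk0 (2 * Real.pi) (by positivity))))

theorem fourierSchwartz_apply (φ : 𝓢(ℝ, ℂ)) (η : ℝ) :
    fourierSchwartz φ η = 𝓕 (φ : ℝ → ℂ) (η * (2 * Real.pi)⁻¹) := rfl

theorem fourierSchwartz_fourierSchwartzInv (φ : 𝓢(ℝ, ℂ)) :
    fourierSchwartz (fourierSchwartzInv φ) = φ := by
  set ψ := SchwartzMap.compCLMOfContinuousLinearEquiv ℂ
      (ContinuousLinearEquiv.unitsEquivAut ℝ (Units.mk0 (2 * Real.pi) (by positivity))) φ with hψ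
  ext η
  have h : fourierSchwartz (fourierSchwartzInv φ) η = (𝓕 (𝓕⁻ ψ)) (η * (2 * Real.pi)⁻¹) := rfl
  rw [h, fourier_fourierInv_eq]
  change φ (η * (2 * Real.pi)⁻¹ * (2 * Real.pi)) = φ η
  rw [inv_mul_cancel_right₀ (by positivity)]

theorem fourierSchwartzInv_fourierSchwartz (φ : 𝓢(ℝ, ℂ)) :
    fourierSchwartzInv (fourierSchwartz φ) = φ := by
  have h : (SchwartzMap.compCLMOfContinuousLinearEquiv ℂ
      (ContinuousLinearEquiv.unitsEquivAut ℝ (Units.mk0 (2 * Real.pi) (by positivity))))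
        (fourierSchwartz φ) = 𝓕 φ := by
    ext η
    change 𝓕 (φ : ℝ → ℂ) (η * (2 * Real.pi) * (2 * Real.pi)⁻¹) = 𝓕 (φ : ℝ → ℂ) η
    rw [mul_inv_cancel_right₀ (by positivity)]
  change 𝓕⁻ ((SchwartzMap.compCLMOfContinuousLinearEquiv ℂ
      (ContinuousLinearEquiv.unitsEquivAut ℝ (Units.mk0 (2 * Real.pi) (by positivity))))
        (fourierSchwartz φ)) = φ
  rw [h, fourierInv_fourier_eq]

theorem derivCLM_fourierSchwartz (φ : 𝓢(ℝ, ℂ)) :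
    SchwartzMap.derivCLM ℂ ℂ (fourierSchwartz φ) =
      -fourierSchwartz (SchwartzMap.smulLeftCLM ℂ (fun η : ℝ => Complex.I * (η : ℂ)) φ) := by
  have hM : (fun η : ℝ => Complex.I * (η : ℂ)).HasTemperateGrowth :=
    (Function.HasTemperateGrowth.const _).mul Function.Complex.hasTemperateGrowth_ofReal
  ext η
  rw [SchwartzMap.derivCLM_apply, neg_apply]
  have hint : Integrable (fun x : ℝ => x • φ x) := by
    have h := (SchwartzMap.smulLeftCLM ℂ (fun η : ℝ => (η : ℂ) ^ 1) φ).integrable (μ := volume)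
    refine h.congr (Eventually.of_forall fun x => ?_)
    rw [smulLeft_apply (hasTemperateGrowth_pow 1), pow_one]
    exact (Complex.real_smul).symm
  have h1 := Real.hasDerivAt_fourier φ.integrable hint (η * (2 * Real.pi)⁻¹)
  have h2 := (h1.scomp η ((hasDerivAt_id η).mul_const (2 * Real.pi)⁻¹)).deriv
  have h3 : deriv (fourierSchwartz φ) η = deriv
      (𝓕 (φ : ℝ → ℂ) ∘ fun y => id y * (2 * Real.pi)⁻¹) η := rfl
  rw [h3, h2, fourierSchwartz_apply, Real.fourier_eq', Real.fourier_eq', ← integral_smul,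
    ← integral_neg]
  congr 1
  ext x
  rw [smulLeft_apply hM]
  simp only [smul_eq_mul, Complex.real_smul]
  push_cast
  have : (Real.pi : ℂ) ≠ 0 := by exact_mod_cast Real.pi_ne_zero
  field_simp

/-- The multiplier `iη` of the derivative. -/
theorem dy_fourierSchwartz (T : 𝓢'(ℝ, ℂ)) (φ : 𝓢(ℝ, ℂ)) :
    dy T (fourierSchwartz φ) =
      T (fourierSchwartz (SchwartzMap.smulLeftCLM ℂ (fun η : ℝ => Complex.I * (η : ℂ)) φ)) := by
  rw [dy, TemperedDistribution.derivCLM_apply_apply, derivCLM_fourierSchwartz, neg_neg]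

/-- The Fourier transform is onto, so it suffices to test on transforms; there `∂_y` becomes
multiplication of the test function by `iη`. -/
theorem eq_of_forall_fourierSchwartz {S T : 𝓢'(ℝ, ℂ)}
    (h : ∀ φ, S (fourierSchwartz φ) = T (fourierSchwartz φ)) : S = T := by
  ext φ
  rw [← fourierSchwartz_fourierSchwartzInv φ, h]

variable {ε ν kx ky : ℝ}

theorem temperate_I_mul : (fun η : ℝ => Complex.I * (η : ℂ)).HasTemperateGrowth :=
  (Function.HasTemperateGrowth.const _).mul Function.Complex.hasTemperateGrowth_ofReal

/-- The equation, after a Fourier transform in `y`, is a second order differential equation with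
characteristic exponents `R_-` and `R_+`. -/
theorem equation_iff (hε : 0 < ε) (hν : 0 < ν) (hkx : 0 < kx) (hky : ky ≠ 0)
    (hk : kx ^ 2 + ky ^ 2 = 1) (T₀ T₁ T₂ : 𝓢'(ℝ, ℂ)) :
    Complex.I • ((kx : ℂ) • T₁ + (ky : ℂ) • dy T₀)
      + ((ε : ℂ) / 2) • (((kx : ℂ) ^ 2) • dy (dy T₀)
          - (2 * (kx : ℂ) * (ky : ℂ)) • dy T₁ + ((ky : ℂ) ^ 2) • T₂)
      + (Complex.I * (ν : ℂ)) • T₀ = 0 ↔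
    ∀ φ, T₂ (fourierSchwartz φ) =
      T₁ (fourierSchwartz (SchwartzMap.smulLeftCLM ℂ (Rminus ε ν kx ky - negRplus ε ν kx ky) φ)) +
      T₀ (fourierSchwartz
        (SchwartzMap.smulLeftCLM ℂ (Rminus ε ν kx ky * negRplus ε ν kx ky) φ)) := by
  have hR := (isDissipative_Rminus hε hν hkx hky).temperate
  have hP := (isDissipative_negRplus hε hν hkx hky).temperate
  set M := SchwartzMap.smulLeftCLM ℂ (fun η : ℝ => Complex.I * (η : ℂ)) with hMdef
  -- The coefficient of `∂ₓₓ`; it is nonzero, so the equation can be solved for the second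
  -- derivative.
  set κ : ℂ := (ε : ℂ) / 2 * (ky : ℂ) ^ 2 with hκ
  have hκ0 : κ ≠ 0 := by
    have h1 : (ε : ℂ) ≠ 0 := by exact_mod_cast hε.ne'
    have h3 : (ky : ℂ) ≠ 0 := by exact_mod_cast hky
    exact mul_ne_zero (div_ne_zero h1 two_ne_zero) (pow_ne_zero 2 h3)
  have e0 : ∀ φ, (-κ) • SchwartzMap.smulLeftCLM ℂ (Rminus ε ν kx ky * negRplus ε ν kx ky) φ =
      (Complex.I * ky) • M φ + (ε / 2 * (kx : ℂ) ^ 2) • M (M φ) + (Complex.I * ν) • φ := by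
    intro φ
    ext η
    simp only [add_apply, smul_apply, hMdef, smulLeft_apply temperate_I_mul,
      smulLeft_apply (hR.mul hP), smul_eq_mul, Pi.mul_apply]
    have h := coeff_zero_eq (ν := ν) hε hkx hky hk η
    linear_combination (-φ η) * h + (-ky * η * φ η - ε / 2 * (kx : ℂ) ^ 2 * η ^ 2 * φ η) *
      Complex.I_sq
  have e1 : ∀ φ, (-κ) • SchwartzMap.smulLeftCLM ℂ (Rminus ε ν kx ky - negRplus ε ν kx ky) φ =
      (Complex.I * kx) • φ - (ε * kx * ky : ℂ) • M φ := by
    intro φ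
    ext η
    simp only [sub_apply, smul_apply, hMdef, smulLeft_apply temperate_I_mul,
      smulLeft_apply (hR.sub hP), smul_eq_mul, Pi.sub_apply]
    have h := coeff_one_eq (ν := ν) (kx := kx) hε hky η
    linear_combination (-φ η) * h
  have key : ∀ φ, (Complex.I • ((kx : ℂ) • T₁ + (ky : ℂ) • dy T₀)
      + ((ε : ℂ) / 2) • (((kx : ℂ) ^ 2) • dy (dy T₀)
          - (2 * (kx : ℂ) * (ky : ℂ)) • dy T₁ + ((ky : ℂ) ^ 2) • T₂)
      + (Complex.I * (ν : ℂ)) • T₀) (fourierSchwartz φ) = κ * (T₂ (fourierSchwartz φ) -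
      (T₁ (fourierSchwartz
        (SchwartzMap.smulLeftCLM ℂ (Rminus ε ν kx ky - negRplus ε ν kx ky) φ)) +
      T₀ (fourierSchwartz
        (SchwartzMap.smulLeftCLM ℂ (Rminus ε ν kx ky * negRplus ε ν kx ky) φ)))) := by
    intro φ
    have h0 := congrArg (fun ψ => T₀ (fourierSchwartz ψ)) (e0 φ)
    have h1 := congrArg (fun ψ => T₁ (fourierSchwartz ψ)) (e1 φ)
    simp only [map_add, map_sub, map_smul, smul_eq_mul] at h0 h1
    change Complex.I * (kx * T₁ (fourierSchwartz φ) + ky * dy T₀ (fourierSchwartz φ)) +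
      ε / 2 * ((kx : ℂ) ^ 2 * dy (dy T₀) (fourierSchwartz φ) -
        2 * (kx : ℂ) * ky * dy T₁ (fourierSchwartz φ) + (ky : ℂ) ^ 2 * T₂ (fourierSchwartz φ)) +
      Complex.I * ν * T₀ (fourierSchwartz φ) = _
    simp only [dy_fourierSchwartz, ← hMdef]
    rw [hκ] at h0 h1 ⊢
    linear_combination -h0 - h1
  constructor
  · intro h φ
    have h' := key φ
    rw [h] at h'
    change (0 : ℂ) = _ at h'
    exact sub_eq_zero.1 ((mul_eq_zero.1 h'.symm).resolve_left hκ0)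
  · intro h
    refine eq_of_forall_fourierSchwartz fun φ => ?_
    rw [key, h, sub_self, mul_zero]
    rfl

theorem entrance_iff (T₀ T₁ g : 𝓢'(ℝ, ℂ)) :
    (Complex.I * (ε : ℂ) * (ky : ℂ)) • ((kx : ℂ) • dy T₀ - (ky : ℂ) • T₁)
      + (2 * (kx : ℂ)) • T₀ = (2 * (kx : ℂ)) • g ↔
    ∀ φ, T₀ (fourierSchwartz (SchwartzMap.smulLeftCLM ℂ
        (fun η : ℝ => 2 * kx + (-(ε * kx * ky : ℂ)) * (η : ℂ)) φ)) -
      Complex.I * ε * (ky : ℂ) ^ 2 * T₁ (fourierSchwartz φ) =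
        2 * kx * g (fourierSchwartz φ) := by
  have e0 : ∀ φ, SchwartzMap.smulLeftCLM ℂ
        (fun η : ℝ => 2 * kx + (-(ε * kx * ky : ℂ)) * (η : ℂ)) φ =
      (2 * kx : ℂ) • φ + (Complex.I * ε * ky * kx) •
        SchwartzMap.smulLeftCLM ℂ (fun η : ℝ => Complex.I * (η : ℂ)) φ := by
    intro φ
    ext η
    simp only [add_apply, smul_apply, smulLeft_apply temperate_I_mul,
      smulLeft_apply (temperate_affine _ _), smul_eq_mul]
    linear_combination (-(ε * ky * kx * η * φ η)) * Complex.I_sq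
  have key : ∀ φ, ((Complex.I * (ε : ℂ) * (ky : ℂ)) • ((kx : ℂ) • dy T₀ - (ky : ℂ) • T₁)
      + (2 * (kx : ℂ)) • T₀) (fourierSchwartz φ) = T₀ (fourierSchwartz (SchwartzMap.smulLeftCLM ℂ
        (fun η : ℝ => 2 * kx + (-(ε * kx * ky : ℂ)) * (η : ℂ)) φ)) -
      Complex.I * ε * (ky : ℂ) ^ 2 * T₁ (fourierSchwartz φ) := by
    intro φ
    change Complex.I * ε * ky * (kx * dy T₀ (fourierSchwartz φ) - ky * T₁ (fourierSchwartz φ)) +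
      2 * kx * T₀ (fourierSchwartz φ) = _
    rw [e0, dy_fourierSchwartz]
    simp only [map_add, map_smul, smul_eq_mul]
    ring
  constructor
  · intro h φ
    rw [← key, h]
    rfl
  · intro h
    refine eq_of_forall_fourierSchwartz fun φ => ?_
    rw [key, h]
    rfl

end Fourier

/-! ### Restriction to vertical lines and a criterion for temperedness. -/

section Slices

/-- The derivative in the second variable of a Schwartz function on the plane. -/
noncomputable def derivSnd : 𝓢(ℝ × ℝ, ℂ) →L[ℂ] 𝓢(ℝ × ℝ, ℂ) :=
  LineDeriv.lineDerivOpCLM ℂ 𝓢(ℝ × ℝ, ℂ) ((0, 1) : ℝ × ℝ)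

theorem slice_apply (x y : ℝ) (Φ : 𝓢(ℝ × ℝ, ℂ)) : slice x Φ y = Φ (x, y) := rfl

theorem derivCLM_slice (x : ℝ) (Φ : 𝓢(ℝ × ℝ, ℂ)) :
    SchwartzMap.derivCLM ℂ ℂ (slice x Φ) = slice x (derivSnd Φ) := by
  ext y
  rw [SchwartzMap.derivCLM_apply, slice_apply, derivSnd, LineDeriv.lineDerivOpCLM_apply,
    SchwartzMap.lineDerivOp_apply_eq_fderiv]
  have h1 : HasDerivAt (fun t : ℝ => ((x, t) : ℝ × ℝ)) (0, 1) y :=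
    (hasDerivAt_const y x).prodMk (hasDerivAt_id y)
  exact ((Φ.hasFDerivAt (x, y)).comp_hasDerivAt y h1).deriv

theorem iterate_derivCLM_slice (x : ℝ) (k n : ℕ) (Φ : 𝓢(ℝ × ℝ, ℂ)) :
    SchwartzMap.seminorm ℂ k n (slice x Φ) =
      SchwartzMap.seminorm ℂ k 0 (slice x (derivSnd^[n] Φ)) := by
  induction n generalizing Φ with
  | zero => rfl
  | succ n ih => rw [seminorm_succ, derivCLM_slice, ih, Function.iterate_succ_apply]

theorem seminorm_slice_le (x : ℝ) (k n : ℕ) (Φ : 𝓢(ℝ × ℝ, ℂ)) :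
    SchwartzMap.seminorm ℂ k n (slice x Φ) ≤ SchwartzMap.seminorm ℂ k 0 (derivSnd^[n] Φ) := by
  rw [iterate_derivCLM_slice]
  refine seminorm_zero_le_bound k _ (apply_nonneg _ _) fun y => ?_
  have h := SchwartzMap.norm_pow_mul_le_seminorm ℂ (derivSnd^[n] Φ) k (x, y)
  have h1 : |y| ≤ ‖((x, y) : ℝ × ℝ)‖ := norm_snd_le (x, y)
  refine le_trans ?_ h
  rw [slice_apply]
  gcongr

/-- Slicing commutes with `∂_y`, which reduces to `n = 0`; there it is the mean value inequality in
the first variable. -/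
theorem seminorm_slice_sub_le (x x' : ℝ) (k n : ℕ) (Φ : 𝓢(ℝ × ℝ, ℂ)) :
    SchwartzMap.seminorm ℂ k n (slice x' Φ - slice x Φ) ≤
      SchwartzMap.seminorm ℂ k 1 (derivSnd^[n] Φ) * |x' - x| := by
  have hi : ∀ (n : ℕ) (Φ : 𝓢(ℝ × ℝ, ℂ)), SchwartzMap.seminorm ℂ k n (slice x' Φ - slice x Φ) =
      SchwartzMap.seminorm ℂ k 0 (slice x' (derivSnd^[n] Φ) - slice x (derivSnd^[n] Φ)) := by
    intro n
    induction n with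
    | zero => exact fun _ => rfl
    | succ n ih =>
      intro Φ
      rw [seminorm_succ, map_sub, derivCLM_slice, derivCLM_slice, ih, Function.iterate_succ_apply]
  rw [hi]
  set Ψ := derivSnd^[n] Φ
  refine seminorm_zero_le_bound k _ (by positivity) fun y => ?_
  have h := Convex.norm_image_sub_le_of_norm_hasDerivWithin_le (s := univ) (x := x) (y := x')
    (f := fun t : ℝ => |y| ^ k • Ψ (t, y)) (f' := fun t => |y| ^ k • fderiv ℝ Ψ (t, y) (1, 0))
    (C := SchwartzMap.seminorm ℂ k 1 Ψ)
    (fun t _ => ?_) (fun t _ => ?_) convex_univ trivial trivial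
  · rw [← smul_sub, norm_smul, norm_pow, Real.norm_eq_abs, abs_abs] at h
    exact h
  · have h1 : HasDerivAt (fun t : ℝ => ((t, y) : ℝ × ℝ)) (1, 0) t :=
      (hasDerivAt_id t).prodMk (hasDerivAt_const t y)
    exact (((Ψ.hasFDerivAt (t, y)).comp_hasDerivAt t h1).const_smul (|y| ^ k)).hasDerivWithinAt
  · have h1 := SchwartzMap.le_seminorm ℂ k 1 Ψ (t, y)
    have h2 : |y| ≤ ‖((t, y) : ℝ × ℝ)‖ := norm_snd_le (t, y)
    have h3 : ‖fderiv ℝ Ψ (t, y) (1, 0)‖ ≤ ‖iteratedFDeriv ℝ 1 Ψ (t, y)‖ := by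
      rw [norm_iteratedFDeriv_one]
      refine (ContinuousLinearMap.le_opNorm _ _).trans ?_
      simp [Prod.norm_def]
    rw [norm_smul, norm_pow, Real.norm_eq_abs, abs_abs]
    refine le_trans ?_ h1
    gcongr

theorem finset_sup_seminorm_le (s : Finset (ℕ × ℕ)) (φ : 𝓢(ℝ, ℂ)) :
    (s.sup (schwartzSeminormFamily ℂ ℝ ℂ)) φ ≤ ∑ i ∈ s, SchwartzMap.seminorm ℂ i.1 i.2 φ :=
  Seminorm.finset_sup_apply_le (Finset.sum_nonneg fun _ _ => apply_nonneg _ _) fun _ hi =>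
    Finset.single_le_sum (f := fun i : ℕ × ℕ => SchwartzMap.seminorm ℂ i.1 i.2 φ)
      (fun _ _ => apply_nonneg _ _) hi

theorem continuous_slice (Φ : 𝓢(ℝ × ℝ, ℂ)) : Continuous fun x => slice x Φ := by
  refine continuous_iff_continuousAt.2 fun x => ?_
  refine ((schwartz_withSeminorms ℂ ℝ ℂ).tendsto_nhds _ _).2 ?_
  rintro ⟨k, n⟩ ε hε
  have hc : Continuous fun x' => SchwartzMap.seminorm ℂ k 1 (derivSnd^[n] Φ) * |x' - x| := by
    fun_prop
  filter_upwards [(hc.tendsto' x 0 (by simp)).eventually (gt_mem_nhds hε)] with x' hx'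
  exact (seminorm_slice_sub_le x x' k n Φ).trans_lt hx'

theorem continuousOn_apply_slice {v : ℝ → 𝓢'(ℝ, ℂ)}
    (hc : ∀ φ, ContinuousOn (fun x => v x φ) (Ici 0)) (Φ : 𝓢(ℝ × ℝ, ℂ)) :
    ContinuousOn (fun x => v x (slice x Φ)) (Ici 0) := fun x hx =>
  tendsto_apply_of_tendsto (fun φ => hc φ x hx)
    ((continuous_slice Φ).continuousAt.mono_left nhdsWithin_le_nhds)

/-- A weakly continuous family of tempered distributions with sufficient decay is a tempered
distribution on the half-plane. -/
theorem isTempered_of_decay {v : ℝ → 𝓢'(ℝ, ℂ)}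
    (hc : ∀ φ, ContinuousOn (fun x => v x φ) (Ici 0))
    (hb : ∀ φ, ∃ C, ∀ x, 0 ≤ x → (1 + x ^ 2) * ‖v x φ‖ ≤ C) : IsTempered v := by
  -- Banach–Steinhaus for the weighted family `(1 + x²) v(x)` gives one seminorm bound for all `x ≥
  -- 0`, and `(1 + x²)⁻¹` is integrable.
  obtain ⟨s, C, hC, hbound⟩ := exists_bound_of_pointwise_bounded
    (fun x : Ici (0 : ℝ) => ((1 + (x : ℝ) ^ 2 : ℝ) : ℂ) • v x) fun φ => by
      obtain ⟨C, hC⟩ := hb φ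
      refine ⟨C, fun x => ?_⟩
      have h1 : ‖((1 + (x : ℝ) ^ 2 : ℝ) : ℂ) * v x φ‖ ≤ C := by
        rw [norm_mul, Complex.norm_real, Real.norm_of_nonneg (by positivity)]
        exact hC x x.2
      exact h1
  let q : 𝓢(ℝ × ℝ, ℂ) → ℝ := fun Φ =>
    ∑ i ∈ s, SchwartzMap.seminorm ℂ i.1 0 (derivSnd^[i.2] Φ)
  have hq : Continuous q := by
    refine continuous_finsetSum _ fun i _ => ?_
    have h1 : Continuous (derivSnd^[i.2]) := derivSnd.continuous.iterate i.2
    exact ((schwartz_withSeminorms ℂ (ℝ × ℝ) ℂ).continuous_seminorm (i.1, 0)).comp h1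
  have hq0 : q 0 = 0 := by
    refine Finset.sum_eq_zero fun i _ => ?_
    rw [Function.iterate_fixed (map_zero derivSnd), map_zero]
  have hle : ∀ (Φ : 𝓢(ℝ × ℝ, ℂ)) (x : ℝ), 0 ≤ x →
      ‖v x (slice x Φ)‖ ≤ (C * q Φ) * (1 + x ^ 2)⁻¹ := by
    intro Φ x hx
    have h1 : ‖((1 + x ^ 2 : ℝ) : ℂ) * v x (slice x Φ)‖ ≤ _ := hbound ⟨x, hx⟩ (slice x Φ)
    rw [norm_mul, Complex.norm_real, Real.norm_of_nonneg (by positivity)] at h1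
    rw [← div_eq_mul_inv, le_div_iff₀ (by positivity), mul_comm]
    refine h1.trans ?_
    gcongr
    refine (finset_sup_seminorm_le s _).trans ?_
    exact Finset.sum_le_sum fun i _ => seminorm_slice_le x i.1 i.2 Φ
  have hdom : ∀ c : ℝ, IntegrableOn (fun x : ℝ => c * (1 + x ^ 2)⁻¹) (Ioi 0) := fun c =>
    (integrable_inv_one_add_sq.const_mul c).integrableOn
  have hint : ∀ Φ : 𝓢(ℝ × ℝ, ℂ), IntegrableOn (fun x => v x (slice x Φ)) (Ioi 0) := fun Φ =>
    (hdom (C * q Φ)).mono'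
      (((continuousOn_apply_slice hc Φ).mono Ioi_subset_Ici_self).aestronglyMeasurable
        measurableSet_Ioi)
      ((ae_restrict_mem measurableSet_Ioi).mono fun x hx => hle Φ x (le_of_lt hx))
  let L : 𝓢(ℝ × ℝ, ℂ) →ₗ[ℂ] ℂ :=
    { toFun := fun Φ => ∫ x in Ioi (0 : ℝ), v x (slice x Φ)
      map_add' := fun Φ Ψ => by
        rw [← integral_add (hint Φ) (hint Ψ)]
        simp only [map_add]
      map_smul' := fun c Φ => by
        rw [RingHom.id_apply, ← integral_smul]
        simp only [map_smul] }
  have hL : ∀ Φ, ‖L Φ‖ ≤ ∫ x in Ioi (0 : ℝ), (C * q Φ) * (1 + x ^ 2)⁻¹ := fun Φ =>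
    norm_integral_le_of_norm_le (hdom _)
      ((ae_restrict_mem measurableSet_Ioi).mono fun x hx => hle Φ x (le_of_lt hx))
  have hLc : Continuous L := by
    refine continuous_of_continuousAt_zero L ?_
    rw [ContinuousAt, map_zero]
    refine squeeze_zero_norm hL ?_
    simp only [integral_const_mul]
    have h1 : Continuous fun Φ => C * q Φ * ∫ x in Ioi (0 : ℝ), (1 + x ^ 2 : ℝ)⁻¹ :=
      (continuous_const.mul hq).mul continuous_const
    exact h1.tendsto' 0 0 (by simp [hq0])
  exact ⟨ContinuousLinearMap.toUniformConvergenceCLM _ _ _ ⟨L, hLc⟩, fun Φ _ => rfl⟩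

end Slices

/-! ### Families with Fourier transform `exp (A x) T`. -/

section Evolution

/-- The family of tempered distributions with Fourier transform `exp (A x) T`. -/
noncomputable def evolution (A : ℝ → ℂ) (T : 𝓢'(ℝ, ℂ)) (x : ℝ) : 𝓢'(ℝ, ℂ) :=
  PointwiseConvergenceCLM.precomp ℂ ((expMul A x).comp fourierSchwartzInv) T

variable {A : ℝ → ℂ}

theorem evolution_apply (T : 𝓢'(ℝ, ℂ)) (x : ℝ) (φ : 𝓢(ℝ, ℂ)) :
    evolution A T x φ = T (expMul A x (fourierSchwartzInv φ)) := rfl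

theorem evolution_fourierSchwartz (T : 𝓢'(ℝ, ℂ)) (x : ℝ) (φ : 𝓢(ℝ, ℂ)) :
    evolution A T x (fourierSchwartz φ) = T (expMul A x φ) := by
  rw [evolution_apply, fourierSchwartzInv_fourierSchwartz]

theorem hasDerivWithinAt_evolution (hA : IsDissipative A) (T : 𝓢'(ℝ, ℂ)) {x : ℝ} (hx : 0 ≤ x)
    (φ : 𝓢(ℝ, ℂ)) :
    HasDerivWithinAt (fun t => evolution A T t φ)
      (evolution A (TemperedDistribution.smulLeftCLM ℂ A T) x φ) (Ici 0) x := by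
  have h := hasDerivWithinAt_apply_family (T := fun _ => T) (T' := 0) (s := Ici 0)
    (fun ψ => (hasDerivWithinAt_const x (Ici 0) (T ψ)))
    (tendsto_slope_expMul hA hx (fourierSchwartzInv φ))
  refine h.congr_deriv ?_
  rw [evolution_apply, TemperedDistribution.smulLeftCLM_apply_apply,
    smulLeft_expMul hA hA.temperate hx]
  exact zero_add _

theorem dx_eq_of_eqOn_evolution (hA : IsDissipative A) {T : 𝓢'(ℝ, ℂ)} {v : ℝ → 𝓢'(ℝ, ℂ)}
    (hv : EqOn v (evolution A T) (Ici 0)) {x : ℝ} (hx : 0 ≤ x) :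
    DifferentiableWithinAt ℝ v (Ici 0) x ∧
      dx v x = evolution A (TemperedDistribution.smulLeftCLM ℂ A T) x :=
  differentiableWithinAt_and_derivWithin_eq (uniqueDiffOn_Ici 0 x hx) fun φ =>
    (hasDerivWithinAt_evolution hA T hx φ).congr (fun t ht => by rw [hv ht]) (by rw [hv hx])

/-- Each `∂ₓ` replaces `T` by `A T`, so every iterated derivative is again an evolution. -/
theorem isSmooth_evolution (hA : IsDissipative A) (T : 𝓢'(ℝ, ℂ)) : IsSmooth (evolution A T) := by
  have h : ∀ n : ℕ, EqOn (dx^[n] (evolution A T))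
      (evolution A ((TemperedDistribution.smulLeftCLM ℂ A)^[n] T)) (Ici 0) := by
    intro n
    induction n with
    | zero => exact fun _ _ => rfl
    | succ n ih =>
      intro x hx
      rw [Function.iterate_succ_apply', Function.iterate_succ_apply']
      exact (dx_eq_of_eqOn_evolution hA ih hx).2
  exact fun n x hx => (dx_eq_of_eqOn_evolution hA (h n) hx).1

theorem isTempered_evolution (hA : IsDissipative A) (T : 𝓢'(ℝ, ℂ)) :
    IsTempered (evolution A T) := by
  refine isTempered_of_decay
    (fun φ x hx => (hasDerivWithinAt_evolution hA T hx φ).continuousWithinAt) fun φ => ?_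
  obtain ⟨s, C, hC, hT⟩ := exists_bound T
  -- Only the powers `K = 0` and `K = 2` are used, to match the weight `1 + x²`.
  choose c hc using fun K (i : ℕ × ℕ) =>
    exists_pow_mul_seminorm_expMul_le hA i.2 i.1 K (fourierSchwartzInv φ)
  refine ⟨C * ∑ i ∈ s, (c 0 i + c 2 i), fun x hx => ?_⟩
  rw [evolution_apply]
  calc _ ≤ (1 + x ^ 2) * (C * ∑ i ∈ s, SchwartzMap.seminorm ℂ i.1 i.2
          (expMul A x (fourierSchwartzInv φ))) := by
        gcongr
        refine (hT _).trans ?_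
        gcongr
        exact finset_sup_seminorm_le s _
    _ = C * ∑ i ∈ s, (x ^ 0 * SchwartzMap.seminorm ℂ i.1 i.2
          (expMul A x (fourierSchwartzInv φ)) + x ^ 2 * SchwartzMap.seminorm ℂ i.1 i.2
          (expMul A x (fourierSchwartzInv φ))) := by
        simp only [pow_zero, one_mul, Finset.sum_add_distrib, ← Finset.mul_sum]
        ring
    _ ≤ _ := by
        gcongr with i _
        · exact hc 0 i x hx
        · exact hc 2 i x hx

end Evolution

/-! ### Existence and the explicit formula. -/

section Existence

variable {ε ν kx ky : ℝ}

/-- The solution of the half-plane problem. -/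
noncomputable def solution (ε ν kx ky : ℝ) (g : 𝓢'(ℝ, ℂ)) : ℝ → 𝓢'(ℝ, ℂ) :=
  evolution (Rminus ε ν kx ky)
    (TemperedDistribution.smulLeftCLM ℂ (amplitude ε ν kx ky) (fourierY g))

theorem temperate_solutionSymbol (hε : 0 < ε) (hν : 0 < ν) (hkx : 0 < kx) (hky : ky ≠ 0)
    {x : ℝ} (hx : 0 ≤ x) : (solutionSymbol ε ν kx ky x).HasTemperateGrowth :=
  (temperate_amplitude hε hν hkx hky).mul
    ((isDissipative_Rminus hε hν hkx hky).temperate_cexp hx)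

theorem fourierY_apply (T : 𝓢'(ℝ, ℂ)) (φ : 𝓢(ℝ, ℂ)) : fourierY T φ = T (fourierSchwartz φ) := rfl

theorem solution_fourierSchwartz (g : 𝓢'(ℝ, ℂ)) (x : ℝ) (φ : 𝓢(ℝ, ℂ)) :
    solution ε ν kx ky g x (fourierSchwartz φ) = g (fourierSchwartz
      (SchwartzMap.smulLeftCLM ℂ (amplitude ε ν kx ky) (expMul (Rminus ε ν kx ky) x φ))) := by
  rw [solution, evolution_fourierSchwartz]
  rfl

theorem fourierY_solution (hε : 0 < ε) (hν : 0 < ν) (hkx : 0 < kx) (hky : ky ≠ 0)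
    (g : 𝓢'(ℝ, ℂ)) {x : ℝ} (hx : 0 ≤ x) :
    fourierY (solution ε ν kx ky g x) =
      TemperedDistribution.smulLeftCLM ℂ (solutionSymbol ε ν kx ky x) (fourierY g) := by
  ext φ
  rw [fourierY_apply, solution_fourierSchwartz, TemperedDistribution.smulLeftCLM_apply_apply,
    fourierY_apply]
  have h : SchwartzMap.smulLeftCLM ℂ (amplitude ε ν kx ky) (expMul (Rminus ε ν kx ky) x φ) =
      SchwartzMap.smulLeftCLM ℂ (solutionSymbol ε ν kx ky x) φ := by
    ext η
    rw [smulLeft_apply (temperate_amplitude hε hν hkx hky),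
      expMul_apply (isDissipative_Rminus hε hν hkx hky) hx,
      smulLeft_apply (temperate_solutionSymbol hε hν hkx hky hx), solutionSymbol, amplitude]
    ring
  rw [h]

theorem differentiableWithinAt_fourierY_solution (hε : 0 < ε) (hν : 0 < ν) (hkx : 0 < kx)
    (hky : ky ≠ 0) (g : 𝓢'(ℝ, ℂ)) {x : ℝ} (hx : 0 ≤ x) :
    DifferentiableWithinAt ℝ (fun t => fourierY (solution ε ν kx ky g t)) (Ici 0) x ∧
      dx (fun t => fourierY (solution ε ν kx ky g t)) x = TemperedDistribution.smulLeftCLM ℂ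
        (Rminus ε ν kx ky) (fourierY (solution ε ν kx ky g x)) := by
  have hA := isDissipative_Rminus hε hν hkx hky
  refine differentiableWithinAt_and_derivWithin_eq (uniqueDiffOn_Ici 0 x hx) fun φ => ?_
  change HasDerivWithinAt (fun t => evolution (Rminus ε ν kx ky)
    (TemperedDistribution.smulLeftCLM ℂ (amplitude ε ν kx ky) (fourierY g)) t
      (fourierSchwartz φ)) _ _ _
  refine (hasDerivWithinAt_evolution hA _ hx (fourierSchwartz φ)).congr_deriv ?_
  rw [evolution_fourierSchwartz]
  refine (TemperedDistribution.smulLeftCLM_apply_apply _ _ _).trans ?_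
  refine Eq.trans ?_ (TemperedDistribution.smulLeftCLM_apply_apply _ _ _).symm
  rw [fourierY_apply, smulLeft_expMul hA hA.temperate hx, solution, evolution_fourierSchwartz]

theorem isSolution_solution (hε : 0 < ε) (hν : 0 < ν) (hkx : 0 < kx) (hky : ky ≠ 0)
    (hk : kx ^ 2 + ky ^ 2 = 1) (g : 𝓢'(ℝ, ℂ)) :
    IsSolution ε ν kx ky g (solution ε ν kx ky g) := by
  have hA := isDissipative_Rminus hε hν hkx hky
  have hP := (isDissipative_negRplus hε hν hkx hky).temperate
  have hb := temperate_amplitude hε hν hkx hky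
  set T := TemperedDistribution.smulLeftCLM ℂ (amplitude ε ν kx ky) (fourierY g) with hT
  set R := Rminus ε ν kx ky with hR
  have hd1 : EqOn (dx (solution ε ν kx ky g))
      (evolution R (TemperedDistribution.smulLeftCLM ℂ R T)) (Ici 0) := fun x hx =>
    (dx_eq_of_eqOn_evolution hA (fun _ _ => rfl) hx).2
  have hd2 : EqOn (dx (dx (solution ε ν kx ky g))) (evolution R
      (TemperedDistribution.smulLeftCLM ℂ R (TemperedDistribution.smulLeftCLM ℂ R T)))
      (Ici 0) := fun x hx => (dx_eq_of_eqOn_evolution hA hd1 hx).2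
  refine ⟨isSmooth_evolution hA T, isTempered_evolution hA T, fun x hx => ?_, ?_⟩
  · rw [equation_iff hε hν hkx hky hk]
    intro φ
    rw [hd1 hx, hd2 hx, solution, ← hT, ← hR]
    simp only [evolution_fourierSchwartz, TemperedDistribution.smulLeftCLM_apply_apply]
    rw [← map_add T]
    congr 1
    ext η
    simp only [add_apply, smulLeft_apply hA.temperate, expMul_apply hA hx,
      smulLeft_apply (hA.temperate.sub hP), smulLeft_apply (hA.temperate.mul hP), Pi.sub_apply,
      Pi.mul_apply]
    ring
  · rw [SatisfiesEntrance, entrance_iff]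
    intro φ
    rw [hd1 self_mem_Ici, solution, ← hT, ← hR]
    simp only [evolution_fourierSchwartz, TemperedDistribution.smulLeftCLM_apply_apply,
      expMul_zero hA]
    have e1 : ∀ (c : ℂ) (ψ χ : 𝓢(ℝ, ℂ)), T ψ - c * T χ = T (ψ - c • χ) := fun c ψ χ => by
      rw [map_sub, map_smul, smul_eq_mul]
    have e2 : 2 * (kx : ℂ) * g (fourierSchwartz φ) = g (fourierSchwartz ((2 * kx : ℂ) • φ)) := by
      rw [map_smul, map_smul, smul_eq_mul]
    rw [e1, e2, hT, TemperedDistribution.smulLeftCLM_apply_apply]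
    refine congrArg (fun ψ => g (fourierSchwartz ψ)) ?_
    ext η
    simp only [sub_apply, smul_apply, smulLeft_apply hb, smulLeft_apply hA.temperate,
      smulLeft_apply (temperate_affine _ _), smul_eq_mul]
    have h1 := entrance_coeff_eq (ν := ν) (kx := kx) hε hky η
    have h2 := amplitude_mul (ε := ε) (ν := ν) (kx := kx) (ky := ky) η
    linear_combination (amplitude ε ν kx ky η * φ η) * h1 + kx * φ η * h2

end Existence

/-! ### Tensor products of test functions, and their translates. -/

section Tensor

theorem norm_iteratedFDeriv_comp_clm_le (θ : 𝓢(ℝ, ℂ)) (L : ℝ × ℝ →L[ℝ] ℝ) (hL : ‖L‖ ≤ 1) (i : ℕ)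
    (p : ℝ × ℝ) : ‖iteratedFDeriv ℝ i (θ ∘ L) p‖ ≤ ‖iteratedFDeriv ℝ i θ (L p)‖ := by
  rw [L.iteratedFDeriv_comp_right (θ.smooth i) p le_rfl]
  refine (ContinuousMultilinearMap.norm_compContinuousLinearMap_le _ _).trans ?_
  refine mul_le_of_le_one_right (norm_nonneg _) ?_
  rw [Finset.prod_const]
  exact pow_le_one₀ (norm_nonneg _) hL

/-- Leibniz's rule together with `‖p‖ ≤ (1 + ‖p.1‖) (1 + ‖p.2‖)`. The bound is a product of one
seminorm of each factor, so growth in `θ` can be traded against decay in `φ`. -/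
theorem norm_pow_mul_iteratedFDeriv_tensor_le (θ φ : 𝓢(ℝ, ℂ)) (k n : ℕ) (p : ℝ × ℝ) :
    ‖p‖ ^ k * ‖iteratedFDeriv ℝ n (fun p : ℝ × ℝ => θ p.1 * φ p.2) p‖ ≤
      2 ^ n * (2 ^ k * (Finset.Iic (k, n)).sup (schwartzSeminormFamily ℂ ℝ ℂ) θ) *
        (2 ^ k * (Finset.Iic (k, n)).sup (schwartzSeminormFamily ℂ ℝ ℂ) φ) := by
  set P := (Finset.Iic (k, n)).sup (schwartzSeminormFamily ℂ ℝ ℂ)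
  have h1 : ContDiff ℝ n (θ ∘ ContinuousLinearMap.fst ℝ ℝ ℝ) :=
    (θ.smooth n).comp (ContinuousLinearMap.contDiff _)
  have h2 : ContDiff ℝ n (φ ∘ ContinuousLinearMap.snd ℝ ℝ ℝ) :=
    (φ.smooth n).comp (ContinuousLinearMap.contDiff _)
  have h := norm_iteratedFDeriv_mul_le h1 h2 p (n := n) le_rfl
  have hp : ‖p‖ ^ k ≤ (1 + ‖p.1‖) ^ k * (1 + ‖p.2‖) ^ k := by
    rw [← mul_pow]
    gcongr
    rw [Prod.norm_def]
    refine max_le ?_ ?_ <;> nlinarith [norm_nonneg p.1, norm_nonneg p.2]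
  calc _ ≤ ((1 + ‖p.1‖) ^ k * (1 + ‖p.2‖) ^ k) * ∑ i ∈ Finset.range (n + 1), (n.choose i : ℝ) *
          ‖iteratedFDeriv ℝ i (θ ∘ ContinuousLinearMap.fst ℝ ℝ ℝ) p‖ *
          ‖iteratedFDeriv ℝ (n - i) (φ ∘ ContinuousLinearMap.snd ℝ ℝ ℝ) p‖ :=
        mul_le_mul hp h (norm_nonneg _) (by positivity)
    _ = ∑ i ∈ Finset.range (n + 1), (n.choose i : ℝ) *
          ((1 + ‖p.1‖) ^ k * ‖iteratedFDeriv ℝ i (θ ∘ ContinuousLinearMap.fst ℝ ℝ ℝ) p‖) *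
          ((1 + ‖p.2‖) ^ k *
            ‖iteratedFDeriv ℝ (n - i) (φ ∘ ContinuousLinearMap.snd ℝ ℝ ℝ) p‖) := by
        rw [Finset.mul_sum]
        exact Finset.sum_congr rfl fun i _ => by ring
    _ ≤ ∑ i ∈ Finset.range (n + 1), (n.choose i : ℝ) * (2 ^ k * P θ) * (2 ^ k * P φ) := by
        refine Finset.sum_le_sum fun i hi => ?_
        have hin : i ≤ n := Nat.lt_succ_iff.1 (Finset.mem_range.1 hi)
        have a1 := SchwartzMap.one_add_le_sup_seminorm_apply (𝕜 := ℂ) (m := (k, n)) le_rfl hin θ p.1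
        have a2 := SchwartzMap.one_add_le_sup_seminorm_apply (𝕜 := ℂ) (m := (k, n)) le_rfl
          (n.sub_le i) φ p.2
        have b1 := norm_iteratedFDeriv_comp_clm_le θ (ContinuousLinearMap.fst ℝ ℝ ℝ)
          (ContinuousLinearMap.norm_fst_le ℝ ℝ ℝ) i p
        have b2 := norm_iteratedFDeriv_comp_clm_le φ (ContinuousLinearMap.snd ℝ ℝ ℝ)
          (ContinuousLinearMap.norm_snd_le ℝ ℝ ℝ) (n - i) p
        refine mul_le_mul (mul_le_mul_of_nonneg_left
          ((mul_le_mul_of_nonneg_left b1 (by positivity)).trans a1) (by positivity))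
          ((mul_le_mul_of_nonneg_left b2 (by positivity)).trans a2) (by positivity) (by positivity)
    _ = _ := by
        rw [← Finset.sum_mul, ← Finset.sum_mul]
        congr 2
        exact_mod_cast Nat.sum_range_choose n

/-- The tensor product `(x, y) ↦ θ x * φ y` of two Schwartz functions. -/
noncomputable def tensor (θ φ : 𝓢(ℝ, ℂ)) : 𝓢(ℝ × ℝ, ℂ) where
  toFun p := θ p.1 * φ p.2
  smooth' := ((θ.smooth ⊤).comp contDiff_fst).mul ((φ.smooth ⊤).comp contDiff_snd)
  decay' k n := ⟨_, norm_pow_mul_iteratedFDeriv_tensor_le θ φ k n⟩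

theorem tensor_apply (θ φ : 𝓢(ℝ, ℂ)) (p : ℝ × ℝ) : tensor θ φ p = θ p.1 * φ p.2 := rfl

theorem seminorm_tensor_le (θ φ : 𝓢(ℝ, ℂ)) (k n : ℕ) :
    SchwartzMap.seminorm ℂ k n (tensor θ φ) ≤
      2 ^ n * (2 ^ k * (Finset.Iic (k, n)).sup (schwartzSeminormFamily ℂ ℝ ℂ) θ) *
        (2 ^ k * (Finset.Iic (k, n)).sup (schwartzSeminormFamily ℂ ℝ ℂ) φ) :=
  SchwartzMap.seminorm_le_bound ℂ k n _ (by positivity)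
    (norm_pow_mul_iteratedFDeriv_tensor_le θ φ k n)

theorem slice_tensor (x : ℝ) (θ φ : 𝓢(ℝ, ℂ)) : slice x (tensor θ φ) = θ x • φ := rfl

theorem continuous_sup_seminorm (s : Finset (ℕ × ℕ)) :
    Continuous ⇑(s.sup (schwartzSeminormFamily ℂ ℝ ℂ)) :=
  Seminorm.continuous_finsetSup fun i _ => (schwartz_withSeminorms ℂ ℝ ℂ).continuous_seminorm i

theorem tendsto_tensor (θ : 𝓢(ℝ, ℂ)) {φ : ℕ → 𝓢(ℝ, ℂ)} {φ₀ : 𝓢(ℝ, ℂ)}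
    (h : Tendsto φ atTop (𝓝 φ₀)) : Tendsto (fun m => tensor θ (φ m)) atTop (𝓝 (tensor θ φ₀)) := by
  refine ((schwartz_withSeminorms ℂ (ℝ × ℝ) ℂ).tendsto_nhds _ _).2 ?_
  rintro ⟨k, n⟩ ε hε
  set P := (Finset.Iic (k, n)).sup (schwartzSeminormFamily ℂ ℝ ℂ)
  have h0 : Tendsto (fun m => φ m - φ₀) atTop (𝓝 0) := by simpa using h.sub_const φ₀
  have h1 : Tendsto (fun m => 2 ^ n * (2 ^ k * P θ) * (2 ^ k * P (φ m - φ₀))) atTop (𝓝 0) := by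
    have h2 := ((continuous_sup_seminorm (Finset.Iic (k, n))).tendsto' 0 0 (map_zero _)).comp h0
    simpa using (h2.const_mul (2 ^ k)).const_mul (2 ^ n * (2 ^ k * P θ))
  filter_upwards [h1.eventually (gt_mem_nhds hε)] with m hm
  have e : tensor θ (φ m) - tensor θ φ₀ = tensor θ (φ m - φ₀) := by
    ext p
    rw [sub_apply, tensor_apply, tensor_apply, tensor_apply, sub_apply, mul_sub]
  rw [e]
  exact (seminorm_tensor_le _ _ k n).trans_lt hm

theorem hasCompactSupport_tensor {θ φ : 𝓢(ℝ, ℂ)} (hθ : HasCompactSupport θ)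
    (hφ : HasCompactSupport φ) : HasCompactSupport (tensor θ φ) := by
  refine HasCompactSupport.intro (hθ.isCompact.prod hφ.isCompact) fun p hp => ?_
  rw [mem_prod, not_and_or] at hp
  rw [tensor_apply]
  rcases hp with h | h
  · rw [image_eq_zero_of_notMem_tsupport h, zero_mul]
  · rw [image_eq_zero_of_notMem_tsupport h, mul_zero]

/-- Since `‖x‖ ≤ (1 + a) (1 + ‖x - a‖)`, translation costs only a power of `1 + a`. -/
theorem sup_seminorm_shift_le (θ : 𝓢(ℝ, ℂ)) {a : ℝ} (ha : 0 ≤ a) (m : ℕ × ℕ) :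
    (Finset.Iic m).sup (schwartzSeminormFamily ℂ ℝ ℂ) (SchwartzMap.compSubConstCLM ℂ a θ) ≤
      (1 + a) ^ m.1 * (2 ^ m.1 * (Finset.Iic m).sup (schwartzSeminormFamily ℂ ℝ ℂ) θ) := by
  refine Seminorm.finset_sup_apply_le (by positivity) fun i hi => ?_
  have him := Finset.mem_Iic.1 hi
  refine SchwartzMap.seminorm_le_bound ℂ i.1 i.2 _ (by positivity) fun x => ?_
  have e : iteratedFDeriv ℝ i.2 (SchwartzMap.compSubConstCLM ℂ a θ) x =
      iteratedFDeriv ℝ i.2 θ (x - a) := iteratedFDeriv_comp_sub i.2 a x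
  have h := SchwartzMap.one_add_le_sup_seminorm_apply (𝕜 := ℂ) (m := m) le_rfl him.2 θ (x - a)
  have h1 : ‖x‖ ≤ (1 + a) * (1 + ‖x - a‖) := by
    have h2 := norm_add_le (x - a) a
    rw [sub_add_cancel, Real.norm_of_nonneg ha] at h2
    nlinarith [norm_nonneg (x - a)]
  have h3 : ‖x‖ ^ i.1 ≤ (1 + a) ^ m.1 * (1 + ‖x - a‖) ^ m.1 := by
    rw [← mul_pow]
    refine (pow_le_pow_left₀ (norm_nonneg _) h1 _).trans (pow_le_pow_right₀ ?_ him.1)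
    nlinarith [norm_nonneg (x - a)]
  rw [e]
  calc _ ≤ ((1 + a) ^ m.1 * (1 + ‖x - a‖) ^ m.1) * ‖iteratedFDeriv ℝ i.2 θ (x - a)‖ := by gcongr
    _ = (1 + a) ^ m.1 * ((1 + ‖x - a‖) ^ m.1 * ‖iteratedFDeriv ℝ i.2 θ (x - a)‖) := by ring
    _ ≤ _ := mul_le_mul_of_nonneg_left h (by positivity)

theorem exists_one_add_pow_mul_seminorm_expMul_le {A : ℝ → ℂ} (hA : IsDissipative A)
    {q : Seminorm ℂ 𝓢(ℝ, ℂ)} (hq : Continuous q) (K : ℕ) (φ : 𝓢(ℝ, ℂ)) :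
    ∃ C : ℝ, ∀ x : ℝ, 0 ≤ x → (1 + x) ^ K * q (expMul A x φ) ≤ C := by
  obtain ⟨s, D, -, hD⟩ := Seminorm.bound_of_continuous (schwartz_withSeminorms ℂ ℝ ℂ) q hq
  choose c hc using fun K (i : ℕ × ℕ) => exists_pow_mul_seminorm_expMul_le hA i.2 i.1 K φ
  refine ⟨D * ∑ i ∈ s, (∑ j ∈ Finset.range (K + 1), (K.choose j : ℝ) * c j i), fun x hx => ?_⟩
  calc _ ≤ (1 + x) ^ K * (D * ∑ i ∈ s, SchwartzMap.seminorm ℂ i.1 i.2 (expMul A x φ)) := by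
        gcongr
        refine (hD _).trans ?_
        exact mul_le_mul_of_nonneg_left (finset_sup_seminorm_le s _) D.2
    _ = D * ∑ i ∈ s, (∑ j ∈ Finset.range (K + 1), (K.choose j : ℝ) *
          (x ^ j * SchwartzMap.seminorm ℂ i.1 i.2 (expMul A x φ))) := by
        rw [add_comm, add_pow, mul_left_comm, Finset.mul_sum]
        congr 1
        refine Finset.sum_congr rfl fun i _ => ?_
        rw [Finset.sum_mul]
        exact Finset.sum_congr rfl fun j _ => by rw [one_pow]; ring
    _ ≤ _ := by
        gcongr with i _ j _
        exact hc j i x hx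

/-- Translates of a fixed function grow polynomially, so their tensor products with rapidly
decreasing families tend to zero. -/
theorem tendsto_tensor_shift_expMul {A : ℝ → ℂ} (hA : IsDissipative A) (θ φ : 𝓢(ℝ, ℂ)) {a : ℝ}
    (ha : 0 ≤ a) (F : 𝓢(ℝ, ℂ) →L[ℂ] 𝓢(ℝ, ℂ)) (U : 𝓢'(ℝ × ℝ, ℂ)) :
    Tendsto (fun n : ℕ => U (tensor (SchwartzMap.compSubConstCLM ℂ (a + n) θ)
      (F (expMul A (n + 1) φ)))) atTop (𝓝 0) := by
  have hU : Continuous U := (U : 𝓢(ℝ × ℝ, ℂ) →L[ℂ] ℂ).continuous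
  refine (hU.tendsto' 0 0 (map_zero _)).comp ?_
  refine ((schwartz_withSeminorms ℂ (ℝ × ℝ) ℂ).tendsto_nhds _ _).2 ?_
  rintro ⟨k, l⟩ ε hε
  set P := (Finset.Iic (k, l)).sup (schwartzSeminormFamily ℂ ℝ ℂ)
  have hPc : Continuous (P.comp (F : 𝓢(ℝ, ℂ) →ₗ[ℂ] 𝓢(ℝ, ℂ))) :=
    (continuous_sup_seminorm _).comp F.continuous
  -- Of the `k + 1` powers, `k` compensate the translation by `a + n` and the last one yields the
  -- factor `1 / (n + 1)`.
  obtain ⟨C, hC⟩ := exists_one_add_pow_mul_seminorm_expMul_le hA hPc (k + 1) φ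
  have hlim : Tendsto (fun n : ℕ => 2 ^ l * (2 ^ k * ((1 + a) ^ k * (2 ^ k * P θ))) * (2 ^ k * C) *
      (1 / ((n : ℝ) + 1))) atTop (𝓝 0) := by
    simpa using tendsto_one_div_add_atTop_nhds_zero_nat.const_mul
      (2 ^ l * (2 ^ k * ((1 + a) ^ k * (2 ^ k * P θ))) * (2 ^ k * C))
  filter_upwards [hlim.eventually (gt_mem_nhds hε)] with n hn
  rw [sub_zero]
  refine lt_of_le_of_lt ?_ hn
  refine (seminorm_tensor_le _ _ k l).trans ?_
  have h1 := sup_seminorm_shift_le θ (add_nonneg ha n.cast_nonneg) (k, l)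
  have h2 : ((n : ℝ) + 2) ^ (k + 1) * P (F (expMul A (n + 1) φ)) ≤ C := by
    have := hC (n + 1) (by positivity)
    rwa [show (1 : ℝ) + (n + 1) = n + 2 by ring] at this
  have h3 : (1 + (a + n)) ^ k ≤ (1 + a) ^ k * ((n : ℝ) + 2) ^ k := by
    rw [← mul_pow]
    gcongr
    nlinarith [(n.cast_nonneg : (0 : ℝ) ≤ n)]
  have hn1 : (0 : ℝ) < (n : ℝ) + 1 := by positivity
  calc _ ≤ 2 ^ l * (2 ^ k * (((1 + a) ^ k * ((n : ℝ) + 2) ^ k) * (2 ^ k * P θ))) *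
          (2 ^ k * P (F (expMul A (n + 1) φ))) := by
        gcongr
        exact h1.trans (by gcongr)
    _ = 2 ^ l * (2 ^ k * ((1 + a) ^ k * (2 ^ k * P θ))) * 2 ^ k *
          ((((n : ℝ) + 2) ^ k * P (F (expMul A (n + 1) φ)) * (n + 1)) * (1 / ((n : ℝ) + 1))) := by
        field_simp
    _ ≤ 2 ^ l * (2 ^ k * ((1 + a) ^ k * (2 ^ k * P θ))) * 2 ^ k * (C * (1 / ((n : ℝ) + 1))) := by
        gcongr
        refine le_trans ?_ h2
        rw [pow_succ]
        have h4 : 0 ≤ ((n : ℝ) + 2) ^ k * P (F (expMul A (n + 1) φ)) := by positivity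
        nlinarith
    _ = _ := by ring

end Tensor

/-! ### Density of compactly supported test functions. -/

section Cutoff

theorem temperate_dilation (g : 𝓢(ℝ, ℂ)) (h : ℝ) :
    (fun η : ℝ => g (h * η)).HasTemperateGrowth :=
  g.hasTemperateGrowth.comp ((ContinuousLinearMap.lsmul ℝ ℝ h : ℝ →L[ℝ] ℝ).hasTemperateGrowth)

theorem derivCLM_dilation (g φ : 𝓢(ℝ, ℂ)) (h : ℝ) :
    SchwartzMap.derivCLM ℂ ℂ (SchwartzMap.smulLeftCLM ℂ (fun η : ℝ => g (h * η)) φ) =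
      SchwartzMap.smulLeftCLM ℂ (fun η : ℝ => g (h * η)) (SchwartzMap.derivCLM ℂ ℂ φ) +
        (h : ℂ) • SchwartzMap.smulLeftCLM ℂ
          (fun η : ℝ => SchwartzMap.derivCLM ℂ ℂ g (h * η)) φ := by
  rw [derivCLM_smulLeft (temperate_dilation g h)]
  congr 1
  ext η
  rw [smulLeft_apply (temperate_dilation g h).deriv, smul_apply,
    smulLeft_apply (temperate_dilation _ h), SchwartzMap.derivCLM_apply]
  have h1 : HasDerivAt (fun η : ℝ => g (h * η)) ((h * 1) • deriv g (h * η)) η :=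
    (g.hasDerivAt (h * η)).scomp η ((hasDerivAt_id η).const_mul h)
  rw [h1.deriv]
  simp only [Complex.real_smul, smul_eq_mul, mul_one]
  ring

theorem exists_seminorm_dilation_le (n k : ℕ) (g φ : 𝓢(ℝ, ℂ)) :
    ∃ C : ℝ, 0 ≤ C ∧ ∀ h ∈ Ioc (0 : ℝ) 1, SchwartzMap.seminorm ℂ k n
      (SchwartzMap.smulLeftCLM ℂ (fun η : ℝ => g (h * η)) φ) ≤ C := by
  induction n generalizing g φ with
  | zero =>
    refine ⟨SchwartzMap.seminorm ℂ 0 0 g * SchwartzMap.seminorm ℂ k 0 φ, by positivity,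
      fun h _ => seminorm_zero_le_bound k _ (by positivity) fun η => ?_⟩
    rw [smulLeft_apply (temperate_dilation g h), norm_mul, mul_left_comm]
    have h1 := SchwartzMap.norm_le_seminorm ℂ g (h * η)
    have h2 := le_seminorm_zero k φ η
    gcongr
  | succ n ih =>
    obtain ⟨C, hC0, hC⟩ := ih g (SchwartzMap.derivCLM ℂ ℂ φ)
    obtain ⟨D, hD0, hD⟩ := ih (SchwartzMap.derivCLM ℂ ℂ g) φ
    refine ⟨C + D, by positivity, fun h hh => ?_⟩
    rw [seminorm_succ, derivCLM_dilation]
    refine (map_add_le_add _ _ _).trans (add_le_add (hC h hh) ?_)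
    rw [map_smul_eq_mul, Complex.norm_real, Real.norm_of_nonneg hh.1.le]
    exact (mul_le_of_le_one_left (apply_nonneg _ _) hh.2).trans (hD h hh)

/-- The difference lives where `h |η| > 1`; inserting this factor gains `h` at the cost of one power
of `η`, which `φ` absorbs. A derivative falling on the cutoff produces a factor `h` by itself. -/
theorem exists_seminorm_cutoff_sub_le {χ : 𝓢(ℝ, ℂ)} (hχ : ∀ η, |η| ≤ 1 → χ η = 1) (n k : ℕ)
    (φ : 𝓢(ℝ, ℂ)) : ∃ C : ℝ, 0 ≤ C ∧ ∀ h ∈ Ioc (0 : ℝ) 1, SchwartzMap.seminorm ℂ k n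
      (SchwartzMap.smulLeftCLM ℂ (fun η : ℝ => χ (h * η)) φ - φ) ≤ C * h := by
  induction n generalizing φ with
  | zero =>
    refine ⟨(SchwartzMap.seminorm ℂ 0 0 χ + 1) * SchwartzMap.seminorm ℂ (k + 1) 0 φ, by positivity,
      fun h hh => seminorm_zero_le_bound k _ (mul_nonneg (by positivity) hh.1.le) fun η => ?_⟩
    have h1 := SchwartzMap.norm_le_seminorm ℂ χ (h * η)
    have h2 := le_seminorm_zero (k + 1) φ η
    rw [sub_apply, smulLeft_apply (temperate_dilation χ h), ← sub_one_mul, norm_mul]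
    rcases le_or_gt (|h * η|) 1 with hle | hlt
    · rw [hχ _ hle, sub_self, norm_zero, zero_mul, mul_zero]
      exact mul_nonneg (by positivity) hh.1.le
    · rw [abs_mul, abs_of_pos hh.1] at hlt
      have h3 : ‖χ (h * η) - 1‖ ≤ SchwartzMap.seminorm ℂ 0 0 χ + 1 := by
        refine (norm_sub_le _ _).trans ?_
        rw [norm_one]
        gcongr
      calc |η| ^ k * (‖χ (h * η) - 1‖ * ‖φ η‖)
          ≤ |η| ^ k * ((SchwartzMap.seminorm ℂ 0 0 χ + 1) * ‖φ η‖) * (h * |η|) := by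
            refine le_trans ?_ (le_mul_of_one_le_right (by positivity) hlt.le)
            gcongr
        _ = (SchwartzMap.seminorm ℂ 0 0 χ + 1) * (|η| ^ (k + 1) * ‖φ η‖) * h := by ring
        _ ≤ _ := by
            have := hh.1.le
            gcongr
  | succ n ih =>
    obtain ⟨C, hC0, hC⟩ := ih (SchwartzMap.derivCLM ℂ ℂ φ)
    obtain ⟨D, hD0, hD⟩ := exists_seminorm_dilation_le n k (SchwartzMap.derivCLM ℂ ℂ χ) φ
    refine ⟨C + D, by positivity, fun h hh => ?_⟩
    rw [seminorm_succ, map_sub, derivCLM_dilation, add_sub_right_comm, add_mul]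
    refine (map_add_le_add _ _ _).trans (add_le_add (hC h hh) ?_)
    rw [map_smul_eq_mul, Complex.norm_real, Real.norm_of_nonneg hh.1.le, mul_comm]
    exact mul_le_mul_of_nonneg_right (hD h hh) hh.1.le

/-- Compactly supported Schwartz functions are dense. -/
theorem exists_hasCompactSupport_tendsto (φ : 𝓢(ℝ, ℂ)) :
    ∃ ψ : ℕ → 𝓢(ℝ, ℂ), (∀ m, HasCompactSupport (ψ m)) ∧ Tendsto ψ atTop (𝓝 φ) := by
  let f : ContDiffBump (0 : ℝ) := ⟨1, 2, one_pos, one_lt_two⟩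
  have hfc : HasCompactSupport fun x : ℝ => (f x : ℂ) :=
    f.hasCompactSupport.comp_left (g := Complex.ofReal) Complex.ofReal_zero
  let χ : 𝓢(ℝ, ℂ) := hfc.toSchwartzMap (Complex.ofRealCLM.contDiff.comp f.contDiff)
  have hχ : ∀ η, |η| ≤ 1 → χ η = 1 := fun η hη => by
    have h : f η = 1 := f.one_of_mem_closedBall (by simpa [f] using hη)
    change ((f η : ℝ) : ℂ) = 1
    rw [h, Complex.ofReal_one]
  let h : ℕ → ℝ := fun m => 1 / ((m : ℝ) + 1)
  have hh : ∀ m, h m ∈ Ioc (0 : ℝ) 1 := fun m => ⟨by positivity, by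
    rw [div_le_one (by positivity)]
    linarith [(m.cast_nonneg : (0 : ℝ) ≤ m)]⟩
  refine ⟨fun m => SchwartzMap.smulLeftCLM ℂ (fun η : ℝ => χ (h m * η)) φ, fun m => ?_, ?_⟩
  · refine HasCompactSupport.intro (isCompact_Icc (a := -(2 * ((m : ℝ) + 1)))
      (b := 2 * ((m : ℝ) + 1))) fun η hη => ?_
    rw [smulLeft_apply (temperate_dilation χ (h m))]
    have h1 : f (h m * η) = 0 := f.zero_of_le_dist (by
      rw [dist_zero_right, Real.norm_eq_abs, abs_mul, abs_of_pos (hh m).1]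
      rw [mem_Icc, ← abs_le, not_le] at hη
      change (2 : ℝ) ≤ 1 / ((m : ℝ) + 1) * |η|
      rw [one_div, inv_mul_eq_div, le_div_iff₀ (by positivity)]
      exact hη.le)
    change ((f (h m * η) : ℝ) : ℂ) * φ η = 0
    rw [h1, Complex.ofReal_zero, zero_mul]
  · refine ((schwartz_withSeminorms ℂ ℝ ℂ).tendsto_nhds _ _).2 ?_
    rintro ⟨k, n⟩ ε hε
    obtain ⟨C, -, hC⟩ := exists_seminorm_cutoff_sub_le hχ n k φ
    have hlim : Tendsto (fun m => C * h m) atTop (𝓝 0) := by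
      simpa [h] using tendsto_one_div_add_atTop_nhds_zero_nat.const_mul C
    filter_upwards [hlim.eventually (gt_mem_nhds hε)] with m hm
    exact (hC _ (hh m)).trans_lt hm

end Cutoff

/-! ### The extension by zero tested on tensor products. -/

section Pairing

/-- The extension by zero of `v` acts on tensor products in the expected way, also without
compact support in the second variable. -/
theorem apply_tensor_eq_integral {v : ℝ → 𝓢'(ℝ, ℂ)}
    (hc : ∀ φ, ContinuousOn (fun x => v x φ) (Ici 0)) {U : 𝓢'(ℝ × ℝ, ℂ)}
    (hU : ∀ Φ : 𝓢(ℝ × ℝ, ℂ), HasCompactSupport Φ → U Φ = ∫ x in Ioi (0 : ℝ), v x (slice x Φ))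
    {θ : 𝓢(ℝ, ℂ)} (hθ : HasCompactSupport θ) (φ : 𝓢(ℝ, ℂ)) :
    U (tensor θ φ) = ∫ x in Ioi (0 : ℝ), θ x * v x φ := by
  obtain ⟨ψ, hψ, hlim⟩ := exists_hasCompactSupport_tendsto φ
  have hUc : Continuous U := (U : 𝓢(ℝ × ℝ, ℂ) →L[ℂ] ℂ).continuous
  have h1 : Tendsto (fun m => U (tensor θ (ψ m))) atTop (𝓝 (U (tensor θ φ))) :=
    (hUc.tendsto _).comp (tendsto_tensor θ hlim)
  have hK : IsCompact (tsupport θ ∩ Ici 0) := hθ.isCompact.inter_right isClosed_Ici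
  -- Weak continuity on the compact set where `θ` lives gives an equicontinuity bound, which
  -- dominates the integrands uniformly in `m`.
  obtain ⟨s, C, hC, hb⟩ := exists_bound_of_pointwise_bounded
    (fun x : ↥(tsupport θ ∩ Ici 0) => v x) fun φ => by
      obtain ⟨C, hC⟩ := hK.exists_bound_of_continuousOn ((hc φ).mono inter_subset_right)
      exact ⟨C, fun x => hC x x.2⟩
  obtain ⟨B, hB⟩ := (((continuous_sup_seminorm s).tendsto φ).comp hlim).bddAbove_range
  have h2 : Tendsto (fun m => ∫ x in Ioi (0 : ℝ), θ x * v x (ψ m)) atTop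
      (𝓝 (∫ x in Ioi (0 : ℝ), θ x * v x φ)) := by
    refine tendsto_integral_of_dominated_convergence (fun x => ‖θ x‖ * (C * B)) (fun m => ?_) ?_
      (fun m => ?_) ?_
    · exact ((θ.continuous.continuousOn.mul ((hc (ψ m)).mono Ioi_subset_Ici_self))
        |>.aestronglyMeasurable measurableSet_Ioi)
    · exact (θ.integrable.norm.mul_const _).integrableOn
    · refine (ae_restrict_mem measurableSet_Ioi).mono fun x hx => ?_
      rw [norm_mul]
      by_cases hxθ : x ∈ tsupport θ
      · refine mul_le_mul_of_nonneg_left ?_ (norm_nonneg _)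
        refine (hb ⟨x, hxθ, Ioi_subset_Ici_self hx⟩ (ψ m)).trans ?_
        exact mul_le_mul_of_nonneg_left (hB ⟨m, rfl⟩) hC
      · rw [image_eq_zero_of_notMem_tsupport hxθ, norm_zero, zero_mul, zero_mul]
    · refine Eventually.of_forall fun x => ?_
      exact (((v x : 𝓢(ℝ, ℂ) →L[ℂ] ℂ).continuous.tendsto φ).comp hlim).const_mul (θ x)
  refine tendsto_nhds_unique h1 (h2.congr fun m => ?_)
  rw [hU _ (hasCompactSupport_tensor hθ (hψ m))]
  refine integral_congr_ae (Eventually.of_forall fun x => ?_)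
  simp only [slice_tensor, map_smul, smul_eq_mul]

theorem continuous_mul_and_hasCompactSupport {θ : 𝓢(ℝ, ℂ)} (hθ : HasCompactSupport θ)
    (hθ0 : tsupport θ ⊆ Ioi 0) {f : ℝ → ℂ} (hf : ContinuousOn f (Ioi 0)) :
    Continuous (fun x => θ x * f x) ∧ HasCompactSupport (fun x => θ x * f x) := by
  have hsub : tsupport (fun x => θ x * f x) ⊆ tsupport θ := tsupport_mul_subset_left
  exact ⟨(θ.continuous.continuousOn.mul hf).continuous_of_tsupport_subset isOpen_Ioi
    (hsub.trans hθ0), hθ.of_isClosed_subset (isClosed_tsupport _) hsub⟩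

theorem integral_mul_deriv_Ioi {θ : 𝓢(ℝ, ℂ)} (hθ : HasCompactSupport θ)
    (hθ0 : tsupport θ ⊆ Ioi 0) {f f' : ℝ → ℂ} (hf : ∀ x ∈ Ioi (0 : ℝ), HasDerivAt f (f' x) x)
    (hf' : ContinuousOn f' (Ioi 0)) :
    ∫ x in Ioi (0 : ℝ), θ x * f' x =
      -∫ x in Ioi (0 : ℝ), SchwartzMap.derivCLM ℂ ℂ θ x * f x := by
  have hfc : ContinuousOn f (Ioi 0) := fun x hx => (hf x hx).continuousAt.continuousWithinAt
  have hθ' := SchwartzMap.tsupport_derivCLM_subset (𝕜 := ℂ) θ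
  obtain ⟨c1, s1⟩ := continuous_mul_and_hasCompactSupport hθ hθ0 hf'
  obtain ⟨c2, s2⟩ := continuous_mul_and_hasCompactSupport
    (hθ.of_isClosed_subset (isClosed_tsupport _) hθ') (hθ'.trans hθ0) hfc
  obtain ⟨c3, s3⟩ := continuous_mul_and_hasCompactSupport hθ hθ0 hfc
  have h0 : θ 0 = 0 := image_eq_zero_of_notMem_tsupport fun h => lt_irrefl (0 : ℝ) (mem_Ioi.1 (hθ0 h))
  have h := integral_Ioi_mul_deriv_eq_deriv_mul (a := 0) (a' := 0) (b' := 0) (u := θ) (v := f)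
    (u' := SchwartzMap.derivCLM ℂ ℂ θ) (v' := f') (fun x _ => θ.hasDerivAt x) hf
    (c1.integrable_of_hasCompactSupport s1).integrableOn
    (c2.integrable_of_hasCompactSupport s2).integrableOn
    ((c3.tendsto' 0 0 (by simp [h0])).mono_left nhdsWithin_le_nhds)
    ((s3.is_zero_at_infty).mono_left atTop_le_cocompact)
  rw [h]
  simp

end Pairing

/-! ### First-order equations: forward evolution and exclusion of the growing mode. -/

section FirstOrder

theorem eq_of_hasDerivWithinAt_zero {s : Set ℝ} (hs : Convex ℝ s) {f : ℝ → ℂ}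
    (hf : ∀ x ∈ s, HasDerivWithinAt f 0 s x) {x y : ℝ} (hx : x ∈ s) (hy : y ∈ s) : f x = f y := by
  have h := hs.norm_image_sub_le_of_norm_hasDerivWithin_le (C := 0) hf (fun _ _ => by simp) hy hx
  rw [zero_mul] at h
  exact sub_eq_zero.1 (norm_le_zero_iff.1 h)

variable {A : ℝ → ℂ} {z : ℝ → 𝓢'(ℝ, ℂ)}

/-- Duality: `t ↦ z t (exp (A (x - t)) φ)` has zero derivative on `[0, x]`; its values at the two
endpoints are compared. -/
theorem apply_eq_apply_zero_expMul (hA : IsDissipative A)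
    (hz : ∀ x, 0 ≤ x → ∀ φ, HasDerivWithinAt (fun t => z t φ)
      (z x (SchwartzMap.smulLeftCLM ℂ A φ)) (Ici 0) x) {x : ℝ} (hx : 0 ≤ x) (φ : 𝓢(ℝ, ℂ)) :
    z x φ = z 0 (expMul A x φ) := by
  have h : ∀ t ∈ Icc 0 x, HasDerivWithinAt (fun t => z t (expMul A (x - t) φ)) 0 (Icc 0 x) t := by
    intro t ht
    have h1 := hasDerivWithinAt_apply_family (T := z)
      (T' := TemperedDistribution.smulLeftCLM ℂ A (z t))
      (fun ψ => (hz t ht.1 ψ).mono Icc_subset_Ici_self)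
      ((tendsto_slope_expMul_sub hA ht.2 φ).mono_left
        (nhdsWithin_mono _ (sdiff_subset_sdiff_left Icc_subset_Iic_self)))
    rwa [TemperedDistribution.smulLeftCLM_apply_apply,
      smulLeft_expMul hA hA.temperate (sub_nonneg.2 ht.2), map_neg, add_neg_cancel] at h1
  have h2 := eq_of_hasDerivWithinAt_zero (convex_Icc 0 x) h (right_mem_Icc.2 hx) (left_mem_Icc.2 hx)
  simpa only [sub_self, sub_zero, expMul_zero hA] using h2

/-- For the equation `z' = -A z` the growth of `z` is exactly offset by the decay of the test
function, so the pairing is constant in `t`. -/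
theorem apply_add_expMul (hA : IsDissipative A)
    (hz : ∀ x, 0 ≤ x → ∀ φ, HasDerivWithinAt (fun t => z t φ)
      (-z x (SchwartzMap.smulLeftCLM ℂ A φ)) (Ici 0) x) {a t : ℝ} (ha : 0 ≤ a) (ht : 0 ≤ t)
    (φ : 𝓢(ℝ, ℂ)) : z (a + t) (expMul A t φ) = z a φ := by
  have h : ∀ s ∈ Ici (0 : ℝ),
      HasDerivWithinAt (fun s => z (a + s) (expMul A s φ)) 0 (Ici 0) s := by
    intro s hs
    have h0 : ∀ ψ, HasDerivWithinAt (fun s => z (a + s) ψ)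
        ((-TemperedDistribution.smulLeftCLM ℂ A (z (a + s))) ψ) (Ici 0) s := by
      intro ψ
      have h2 := (hz (a + s) (add_nonneg ha hs) ψ).scomp s
        (((hasDerivWithinAt_id s (Ici 0)).const_add a)) fun t ht => add_nonneg ha ht
      rwa [one_smul] at h2
    have h1 := hasDerivWithinAt_apply_family h0 (tendsto_slope_expMul hA hs φ)
    rwa [neg_apply, TemperedDistribution.smulLeftCLM_apply_apply,
      smulLeft_expMul hA hA.temperate hs, neg_add_cancel] at h1
  have h2 := eq_of_hasDerivWithinAt_zero (convex_Ici 0) h ht self_mem_Ici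
  simpa only [add_zero, expMul_zero hA] using h2

theorem derivCLM_shift (θ : 𝓢(ℝ, ℂ)) (c : ℝ) :
    SchwartzMap.derivCLM ℂ ℂ (SchwartzMap.compSubConstCLM ℂ c θ) =
      SchwartzMap.compSubConstCLM ℂ c (SchwartzMap.derivCLM ℂ ℂ θ) := by
  ext x
  rw [SchwartzMap.derivCLM_apply]
  exact deriv_comp_sub_const (f := θ) c x

theorem coe_shift (θ : 𝓢(ℝ, ℂ)) (c : ℝ) :
    ⇑(SchwartzMap.compSubConstCLM ℂ c θ) = ⇑θ ∘ ⇑(Homeomorph.subRight c) := rfl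

theorem hasCompactSupport_shift {θ : 𝓢(ℝ, ℂ)} (hθ : HasCompactSupport θ) (c : ℝ) :
    HasCompactSupport (SchwartzMap.compSubConstCLM ℂ c θ) := by
  rw [coe_shift]
  exact hθ.comp_homeomorph _

theorem tsupport_shift_subset {θ : 𝓢(ℝ, ℂ)} (hθ : tsupport θ ⊆ Ioi 0) {c : ℝ} (hc : 0 ≤ c) :
    tsupport (SchwartzMap.compSubConstCLM ℂ c θ) ⊆ Ioi 0 := by
  rw [coe_shift, tsupport_comp_eq_preimage]
  intro x hx
  have h1 : 0 < x - c := hθ hx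
  exact mem_Ioi.2 (by linarith)

theorem integral_Ioi_shift_mul {θ : 𝓢(ℝ, ℂ)} (hθ : tsupport θ ⊆ Ioi 0) {c : ℝ} (hc : 0 ≤ c)
    (f : ℝ → ℂ) : ∫ x in Ioi (0 : ℝ), SchwartzMap.compSubConstCLM ℂ c θ x * f x =
      ∫ t, θ t * f (c + t) := by
  rw [setIntegral_eq_integral_of_forall_compl_eq_zero fun x hx => by
      rw [image_eq_zero_of_notMem_tsupport fun h => hx (tsupport_shift_subset hθ hc h), zero_mul],
    ← integral_sub_right_eq_self (fun t => θ t * f (c + t)) c]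
  refine integral_congr_ae (Eventually.of_forall fun x => ?_)
  simp only [coe_shift, Function.comp_apply, Homeomorph.subRight_apply, add_sub_cancel]

/-- The integral equals, for every `n`, the pairing of `z` with `θ` translated by `a + n` and
tensored with `exp (A (n + 1)) φ`. By `hU` this is a pairing with the tempered `U`, which tends to
zero as `n → ∞`. -/
theorem integral_mul_expMul_eq_zero (hA : IsDissipative A)
    (hz : ∀ x, 0 ≤ x → ∀ φ, HasDerivWithinAt (fun t => z t φ)
      (-z x (SchwartzMap.smulLeftCLM ℂ A φ)) (Ici 0) x)
    {U : 𝓢'(ℝ × ℝ, ℂ)} {F G : 𝓢(ℝ, ℂ) →L[ℂ] 𝓢(ℝ, ℂ)}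
    (hU : ∀ θ : 𝓢(ℝ, ℂ), HasCompactSupport θ → tsupport θ ⊆ Ioi 0 → ∀ φ,
      ∫ x in Ioi (0 : ℝ), θ x * z x φ =
        -U (tensor (SchwartzMap.derivCLM ℂ ℂ θ) (F φ)) - U (tensor θ (G φ)))
    {a : ℝ} (ha : 0 ≤ a) (φ : 𝓢(ℝ, ℂ)) {θ : 𝓢(ℝ, ℂ)} (hθ : HasCompactSupport θ)
    (hθ1 : tsupport θ ⊆ Ioo 0 1) : ∫ t, θ t * z a (expMul A (1 - t) φ) = 0 := by
  have hθ0 : tsupport θ ⊆ Ioi 0 := hθ1.trans Ioo_subset_Ioi_self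
  have hn : ∀ n : ℕ, -U (tensor (SchwartzMap.compSubConstCLM ℂ (a + n)
        (SchwartzMap.derivCLM ℂ ℂ θ)) (F (expMul A (n + 1) φ))) -
      U (tensor (SchwartzMap.compSubConstCLM ℂ (a + n) θ) (G (expMul A (n + 1) φ))) =
        ∫ t, θ t * z a (expMul A (1 - t) φ) := by
    intro n
    have han : 0 ≤ a + n := by positivity
    rw [← derivCLM_shift, ← hU _ (hasCompactSupport_shift hθ _) (tsupport_shift_subset hθ0 han),
      integral_Ioi_shift_mul hθ0 han]
    refine integral_congr_ae (Eventually.of_forall fun t => ?_)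
    by_cases ht : t ∈ tsupport θ
    · obtain ⟨h0, h1⟩ := hθ1 ht
      have hnt : 0 ≤ n + t := by positivity
      -- The exponent `n + 1` is split as `(n + t) + (1 - t)`; both parts are nonnegative because
      -- `θ` is supported in `(0, 1)`.
      have h := apply_add_expMul hA hz ha hnt (expMul A (1 - t) φ)
      rw [expMul_expMul hA hnt (sub_nonneg.2 h1.le), show n + t + (1 - t) = n + 1 by ring,
        ← add_assoc] at h
      exact congrArg (θ t * ·) h
    · simp only [image_eq_zero_of_notMem_tsupport ht, zero_mul]
  have hlim := (tendsto_tensor_shift_expMul hA (SchwartzMap.derivCLM ℂ ℂ θ) φ ha F U).neg.sub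
    (tendsto_tensor_shift_expMul hA θ φ ha G U)
  rw [neg_zero, sub_zero] at hlim
  exact tendsto_nhds_unique (tendsto_const_nhds.congr fun n => (hn n).symm) hlim

/-- A backward dissipative evolution vanishes if it is the distributional derivative, in the sense
of `hU`, of a tempered distribution on the half-plane. -/
theorem apply_eq_zero_of_integral_eq (hA : IsDissipative A)
    (hz : ∀ x, 0 ≤ x → ∀ φ, HasDerivWithinAt (fun t => z t φ)
      (-z x (SchwartzMap.smulLeftCLM ℂ A φ)) (Ici 0) x)
    {U : 𝓢'(ℝ × ℝ, ℂ)} {F G : 𝓢(ℝ, ℂ) →L[ℂ] 𝓢(ℝ, ℂ)}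
    (hU : ∀ θ : 𝓢(ℝ, ℂ), HasCompactSupport θ → tsupport θ ⊆ Ioi 0 → ∀ φ,
      ∫ x in Ioi (0 : ℝ), θ x * z x φ =
        -U (tensor (SchwartzMap.derivCLM ℂ ℂ θ) (F φ)) - U (tensor θ (G φ)))
    {a : ℝ} (ha : 0 ≤ a) (φ : 𝓢(ℝ, ℂ)) : z a φ = 0 := by
  set f : ℝ → ℂ := fun t => z a (expMul A (1 - t) φ) with hf
  have hfc : ContinuousOn f (Iic 1) := fun t ht =>
    (hasDerivWithinAt_apply_family (T := fun _ => z a) (T' := 0)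
      (fun ψ => hasDerivWithinAt_const t (Iic 1) (z a ψ))
      (tendsto_slope_expMul_sub hA ht φ)).continuousWithinAt
  have hfi : ContinuousOn f (Ioo 0 1) := hfc.mono fun t ht => ht.2.le
  -- The bump `θ` being arbitrary, the fundamental lemma of the calculus of variations applies.
  have hae : ∀ᵐ t, t ∈ Ioo (0 : ℝ) 1 → f t = 0 := by
    refine isOpen_Ioo.ae_eq_zero_of_integral_contDiff_smul_eq_zero
      (hfi.locallyIntegrableOn measurableSet_Ioo) fun g hg hgc hg1 => ?_
    have hgc' : HasCompactSupport fun x : ℝ => (g x : ℂ) :=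
      hgc.comp_left (g := Complex.ofReal) Complex.ofReal_zero
    have h := integral_mul_expMul_eq_zero hA hz hU ha φ
      (θ := hgc'.toSchwartzMap (Complex.ofRealCLM.contDiff.comp hg)) hgc'
      ((closure_mono (Function.support_comp_subset Complex.ofReal_zero g)).trans hg1)
    refine Eq.trans (integral_congr_ae (Eventually.of_forall fun t => ?_)) h
    exact Complex.real_smul
  have heq : EqOn f 0 (Ioo 0 1) := Measure.eqOn_open_of_ae_eq (μ := volume)
    ((ae_restrict_iff' measurableSet_Ioo).2 hae) isOpen_Ioo hfi continuousOn_const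
  -- Continuity reaches `t = 1`, where the exponential is the identity and `f 1 = z a φ`.
  have heq1 : EqOn f 0 (Ioc 0 1) := heq.of_subset_closure (hfc.mono fun t ht => ht.2)
    continuousOn_const Ioo_subset_Ioc_self (by
      rw [closure_Ioo zero_ne_one]
      exact Ioc_subset_Icc_self)
  have h1 := heq1 (right_mem_Ioc.2 zero_lt_one)
  simpa only [hf, sub_self, expMul_zero hA, Pi.zero_apply] using h1

end FirstOrder

/-! ### Uniqueness of tempered solutions. -/

section Uniqueness

variable {ε ν kx ky : ℝ}

theorem IsSolution.hasDerivWithinAt_apply {g : 𝓢'(ℝ, ℂ)} {v : ℝ → 𝓢'(ℝ, ℂ)}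
    (hv : IsSolution ε ν kx ky g v) {x : ℝ} (hx : 0 ≤ x) (φ : 𝓢(ℝ, ℂ)) :
    HasDerivWithinAt (fun t => v t φ) (dx v x φ) (Ici 0) x :=
  TiltedParaxial.hasDerivWithinAt_apply (hv.smooth 0 x hx) φ

theorem IsSolution.hasDerivWithinAt_dx_apply {g : 𝓢'(ℝ, ℂ)} {v : ℝ → 𝓢'(ℝ, ℂ)}
    (hv : IsSolution ε ν kx ky g v) {x : ℝ} (hx : 0 ≤ x) (φ : 𝓢(ℝ, ℂ)) :
    HasDerivWithinAt (fun t => dx v t φ) (dx (dx v) x φ) (Ici 0) x :=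
  TiltedParaxial.hasDerivWithinAt_apply (hv.smooth 1 x hx) φ

/-- Tempered solutions have no growing mode: they satisfy the first-order equation with
symbol `Rminus`. -/
theorem IsSolution.dx_fourierSchwartz (hε : 0 < ε) (hν : 0 < ν) (hkx : 0 < kx) (hky : ky ≠ 0)
    (hk : kx ^ 2 + ky ^ 2 = 1) {g : 𝓢'(ℝ, ℂ)} {v : ℝ → 𝓢'(ℝ, ℂ)}
    (hv : IsSolution ε ν kx ky g v) {x : ℝ} (hx : 0 ≤ x) (φ : 𝓢(ℝ, ℂ)) :
    dx v x (fourierSchwartz φ) =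
      v x (fourierSchwartz (SchwartzMap.smulLeftCLM ℂ (Rminus ε ν kx ky) φ)) := by
  have hA := isDissipative_negRplus hε hν hkx hky
  have hR := (isDissipative_Rminus hε hν hkx hky).temperate
  set R := SchwartzMap.smulLeftCLM ℂ (Rminus ε ν kx ky) with hRdef
  -- The part of the solution seen by the growing mode: `z = (∂ₓ - R₋) û`, which satisfies `∂ₓ z =
  -- R₊ z` by the factorised equation.
  set z : ℝ → 𝓢'(ℝ, ℂ) := fun x => fourierY (dx v x) -
    TemperedDistribution.smulLeftCLM ℂ (Rminus ε ν kx ky) (fourierY (v x)) with hz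
  have hzx : ∀ x φ, z x φ = dx v x (fourierSchwartz φ) - v x (fourierSchwartz (R φ)) :=
    fun _ _ => rfl
  have hd : ∀ x, 0 ≤ x → ∀ φ, HasDerivWithinAt (fun t => z t φ)
      (-z x (SchwartzMap.smulLeftCLM ℂ (negRplus ε ν kx ky) φ)) (Ici 0) x := by
    intro x hx φ
    have h := (hv.hasDerivWithinAt_dx_apply hx (fourierSchwartz φ)).sub
      (hv.hasDerivWithinAt_apply hx (fourierSchwartz (R φ)))
    have e := (equation_iff hε hν hkx hky hk (v x) (dx v x) (dx (dx v) x)).1 (hv.equation x hx) φ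
    have e1 : -z x (SchwartzMap.smulLeftCLM ℂ (negRplus ε ν kx ky) φ) =
        dx (dx v) x (fourierSchwartz φ) - dx v x (fourierSchwartz (R φ)) := by
      rw [hzx, e, SchwartzMap.smulLeftCLM_sub hR hA.temperate,
        ← SchwartzMap.smulLeftCLM_smulLeftCLM_apply hR hA.temperate, sub_apply, map_sub, map_sub,
        ← hRdef]
      ring
    rw [e1]
    exact h
  obtain ⟨U, hU⟩ := hv.tempered
  have hc : ∀ φ, ContinuousOn (fun x => v x φ) (Ici 0) := fun φ x hx =>
    (hv.hasDerivWithinAt_apply hx φ).continuousWithinAt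
  have hc1 : ∀ φ, ContinuousOn (fun x => dx v x φ) (Ioi 0) := fun φ x hx =>
    ((hv.hasDerivWithinAt_dx_apply (le_of_lt (mem_Ioi.1 hx)) φ).mono
      Ioi_subset_Ici_self).continuousWithinAt
  -- When `z` is integrated against `θ`, the derivative `∂ₓ` moves onto `θ` and gives the `F` term,
  -- while `R₋` stays on the test function and gives the `G` term.
  have h0 := apply_eq_zero_of_integral_eq hA hd (U := U) (F := fourierSchwartz)
    (G := fourierSchwartz.comp R) (fun θ hθ hθ0 φ => ?_) hx φ
  · exact sub_eq_zero.1 ((hzx x φ).symm.trans h0)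
  have hc2 := (hc (fourierSchwartz (R φ))).mono Ioi_subset_Ici_self
  obtain ⟨c1, s1⟩ := continuous_mul_and_hasCompactSupport hθ hθ0 (hc1 (fourierSchwartz φ))
  obtain ⟨c2, s2⟩ := continuous_mul_and_hasCompactSupport hθ hθ0 hc2
  have hθ' := SchwartzMap.tsupport_derivCLM_subset (𝕜 := ℂ) θ
  simp only [hzx, mul_sub]
  rw [integral_sub (c1.integrable_of_hasCompactSupport s1).integrableOn
      (c2.integrable_of_hasCompactSupport s2).integrableOn,
    integral_mul_deriv_Ioi hθ hθ0 (fun x hx => (hv.hasDerivWithinAt_apply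
      (le_of_lt (mem_Ioi.1 hx)) (fourierSchwartz φ)).hasDerivAt (Ici_mem_nhds hx)) (hc1 _),
    ← apply_tensor_eq_integral hc hU (hθ.of_isClosed_subset (isClosed_tsupport _) hθ'),
    ← apply_tensor_eq_integral hc hU hθ]
  rfl

theorem IsSolution.eqOn_solution (hε : 0 < ε) (hν : 0 < ν) (hkx : 0 < kx) (hky : ky ≠ 0)
    (hk : kx ^ 2 + ky ^ 2 = 1) {g : 𝓢'(ℝ, ℂ)} {v : ℝ → 𝓢'(ℝ, ℂ)}
    (hv : IsSolution ε ν kx ky g v) : EqOn v (solution ε ν kx ky g) (Ici 0) := by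
  have hA := isDissipative_Rminus hε hν hkx hky
  have hamp := temperate_amplitude hε hν hkx hky
  have hkx0 : (kx : ℂ) ≠ 0 := by exact_mod_cast hkx.ne'
  have hentr : ∀ φ, v 0 (fourierSchwartz φ) =
      g (fourierSchwartz (SchwartzMap.smulLeftCLM ℂ (amplitude ε ν kx ky) φ)) := by
    intro φ
    -- Testing with the amplitude inverts the entrance symbol, since `amplitude * kx (1 + root) = 2
    -- kx`.
    set ψ := SchwartzMap.smulLeftCLM ℂ (amplitude ε ν kx ky) φ with hψ
    have h := (entrance_iff (v 0) (dx v 0) g).1 hv.entrance ψ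
    rw [hv.dx_fourierSchwartz hε hν hkx hky hk le_rfl] at h
    have e : SchwartzMap.smulLeftCLM ℂ (fun η : ℝ => 2 * kx + (-(ε * kx * ky : ℂ)) * (η : ℂ)) ψ -
        (Complex.I * ε * (ky : ℂ) ^ 2) • SchwartzMap.smulLeftCLM ℂ (Rminus ε ν kx ky) ψ =
          (2 * kx : ℂ) • φ := by
      ext η
      rw [sub_apply, smul_apply, smul_apply, smulLeft_apply (temperate_affine _ _),
        smulLeft_apply hA.temperate, hψ, smulLeft_apply hamp, smul_eq_mul, smul_eq_mul]
      linear_combination (amplitude ε ν kx ky η * φ η) *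
        entrance_coeff_eq (ν := ν) (kx := kx) hε hky η + kx * φ η * amplitude_mul (ε := ε) (ν := ν) (kx := kx) (ky := ky) η
    have h' := congrArg (fun χ => v 0 (fourierSchwartz χ)) e
    simp only [map_sub, map_smul, smul_eq_mul] at h'
    exact mul_left_cancel₀ (mul_ne_zero two_ne_zero hkx0) (h'.symm.trans h)
  intro x hx
  refine eq_of_forall_fourierSchwartz fun φ => ?_
  have h := apply_eq_apply_zero_expMul (z := fun t => fourierY (v t)) hA (fun t ht ψ => ?_) hx φ
  · simp only [fourierY_apply] at h
    rw [h, hentr, solution_fourierSchwartz]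
  · have h1 := hv.hasDerivWithinAt_apply ht (fourierSchwartz ψ)
    rwa [hv.dx_fourierSchwartz hε hν hkx hky hk ht] at h1

end Uniqueness

end TiltedParaxial

/-- Well-posedness and explicit solution of the half-plane tilted paraxial problem. -/
theorem theorem1 (ε ν kx ky : ℝ) (hε : 0 < ε) (hν : 0 < ν) (hkx : 0 < kx) (hky : ky ≠ 0)
    (hk : kx ^ 2 + ky ^ 2 = 1) (g : 𝓢'(ℝ, ℂ)) :
    -- multiplication by the two symbols is a well-defined operation on tempered distributions
    (∀ x : ℝ, 0 ≤ x → (solutionSymbol ε ν kx ky x).HasTemperateGrowth) ∧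
    (Rminus ε ν kx ky).HasTemperateGrowth ∧
    ∃ u : ℝ → 𝓢'(ℝ, ℂ),
      IsSolution ε ν kx ky g u ∧
      (∀ v : ℝ → 𝓢'(ℝ, ℂ), IsSolution ε ν kx ky g v → EqOn v u (Ici 0)) ∧
      (∀ x : ℝ, 0 ≤ x → fourierY (u x) =
        TemperedDistribution.smulLeftCLM ℂ (solutionSymbol ε ν kx ky x) (fourierY g)) ∧
      (∀ x : ℝ, 0 ≤ x →
        DifferentiableWithinAt ℝ (fun t => fourierY (u t)) (Ici 0) x ∧
        dx (fun t => fourierY (u t)) x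
          - TemperedDistribution.smulLeftCLM ℂ (Rminus ε ν kx ky) (fourierY (u x)) = 0) := by
  refine ⟨fun x hx => temperate_solutionSymbol hε hν hkx hky hx,
    (isDissipative_Rminus hε hν hkx hky).temperate, solution ε ν kx ky g,
    isSolution_solution hε hν hkx hky hk g, fun v hv => hv.eqOn_solution hε hν hkx hky hk,
    fun x hx => fourierY_solution hε hν hkx hky g hx, fun x hx => ?_⟩
  obtain ⟨h1, h2⟩ := differentiableWithinAt_fourierY_solution hε hν hkx hky g hx
  exact ⟨h1, sub_eq_zero.2 h2⟩
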